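/- Let $n,p\ge 0$ be integers. For $z\in\mathbb C$ and an integer $k\ge 0$ put $(z)_k=z(z+1)\cdots(z+k-1)$ and $(z)_{-k}=\frac1{(z-1)(z-2)\cdots(z-k)}$, so that $(z)_\nu=\Gamma(z+\nu)/\Gamma(z)$ whenever this quotient exists. For multi-indices put $|m|=m_1+\dots+m_n$. Let $a\in\mathbb C\setminus\{1,2,3,\dots\}$, $b\in\mathbb C^n$, and $c\in\mathbb C^n$ with no $c_i\in\{0,-1,-2,\dots\}$. For $x\in\mathbb C^n$ with $|x_1|+\dots+|x_n|<1$ and $y\in\mathbb C^p$ let $$F_A^{(n)}(a,b;c;x)=\sum_{m\in\mathbb N_0^n}(a)_{|m|}\prod_{i=1}^n\frac{(b_i)_{m_i}}{(c_i)_{m_i}}\frac{x_i^{m_i}}{m_i!},\qquad {}_0F_p(d;y)=\sum_{q\in\mathbb N_0^p}\frac1{(d)_{|q|}}\prod_{j=1}^p\frac{y_j^{q_j}}{q_j!},$$ $$\mathrm H_A^{(n,p)}(a,b;c;x,y)=\sum_{m\in\mathbb N_0^n,\ q\in\mathbb N_0^p}(a)_{|m|-|q|}\prod_{i=1}^n\frac{(b_i)_{m_i}}{(c_i)_{m_i}}\frac{x_i^{m_i}}{m_i!}\prod_{j=1}^p\frac{y_j^{q_j}}{q_j!}.$$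 For $p=1$, ${}_0F_1(d;y)=\sum_{q\ge0}\frac{y^q}{(d)_q\,q!}$. The series for $\mathrm H_A^{(n,p)}(a,b;c;x,y)$, for $F_A^{(n)}(a+|i|,b+i;c+i;x)$ $(i\in\mathbb N_0^n)$, for ${}_0F_p(1-a+l;-y)$ $(l\ge0)$, and for ${}_0F_1(1-a+l;-y_1)$ $(l\ge 0)$ when $p=1$, converge absolutely. Let $\delta_i=x_i\,\partial/\partial x_i$, $\sigma_j=y_j\,\partial/\partial y_j$, and let $$\tilde\nabla^{(n,p)}_{x,y}(h)=\frac{\Gamma(h)\,\Gamma(h+\delta_1+\dots+\delta_n-\sigma_1-\dots-\sigma_p)}{\Gamma(h+\delta_1+\dots+\delta_n)\,\Gamma(h-\sigma_1-\dots-\sigma_p)}$$ be the operator acting on power series in $(x,y)$ that multiplies each monomial $x^my^q$ by $\frac{\Gamma(h)\Gamma(h+|m|-|q|)}{\Gamma(h+|m|)\Gamma(h-|q|)}$. Then the following hold. 1. If $a\notin\mathbb Z$, then for all $x$ with $\sum_i|x_i|<1$ and all $y$ $$\mathrm H_A^{(n,p)}(a,b;c;x,y)=\tilde\nabla^{(n,p)}_{x,y}(a)\,F_A^{(n)}(a,b;c;x)\,{}_0F_p(1-a;-y).$$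 If moreover $\sum_{i=1}^n\max(\operatorname{Re}x_i,0)<\frac12$, then, with the operator series evaluated at $(x,y)$ and converging absolutely, $$\mathrm H_A^{(n,p)}(a,b;c;x,y)=\sum_{k=0}^\infty\frac{(-\delta_1-\dots-\delta_n)_k(\sigma_1+\dots+\sigma_p)_k}{(a)_k\,k!}\Bigl[F_A^{(n)}(a,b;c;x)\,{}_0F_p(1-a;-y)\Bigr].$$ 2. For all $x$ with $\sum_i|x_i|<1$ and $\sum_{i=1}^n\max(\operatorname{Re}x_i,0)<\frac12$, and all $y$, $$\mathrm H_A^{(n,p)}(a,b;c;x,y)=F_A^{(n)}(a,b;c;x)\,{}_0F_p(1-a;-y)$$ $$+\sum_{k=1}^\infty\ \sum_{l=1}^k\ \sum_{\substack{i\in\mathbb N_0^n,\ j\in\mathbb N_0^p\\ |i|=k,\ |j|=l}}\binom{k-1}{l-1}\frac{(-1)^{k+l}\,k!\,\prod_{s=1}^n(b_s)_{i_s}}{(1-a)_l\,\prod_{s=1}^n(c_s)_{i_s}}\ \prod_{s=1}^n\frac{x_s^{i_s}}{i_s!}\ \prod_{t=1}^p\frac{y_t^{j_t}}{j_t!}\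 F_A^{(n)}(a+k,b+i;c+i;x)\ {}_0F_p(1-a+l;-y),$$ where the outer series over $k$ (of the finite inner sums) converges absolutely. 3. For $p=1$ and the same $x$, and all $y_1\in\mathbb C$, $$\mathrm H_A^{(n,1)}(a,b;c;x,y_1)=F_A^{(n)}(a,b;c;x)\,{}_0F_1(1-a;-y_1)$$ $$+\sum_{k=1}^\infty\ \sum_{l=1}^k\ \sum_{\substack{i\in\mathbb N_0^n\\ |i|=k}}\binom{k-1}{l-1}\frac{(-1)^{k+l}\,k!\,\prod_{s=1}^n(b_s)_{i_s}}{(1-a)_l\,\prod_{s=1}^n(c_s)_{i_s}}\ \prod_{s=1}^n\frac{x_s^{i_s}}{i_s!}\ \frac{y_1^l}{l!}\ F_A^{(n)}(a+k,b+i;c+i;x)\ {}_0F_1(1-a+l;-y_1),$$ where the outer series over $k$ converges absolutely. -/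

import Mathlib

open Finset

noncomputable section

/-- The shifted factorial `(z)_k = z (z + 1) ⋯ (z + k - 1)`, with `(z)_0 = 1`. -/
def poch (z : ℂ) (k : ℕ) : ℂ := ∏ r ∈ range k, (z + r)

/-- The shifted factorial `(z)_ν` for an integer `ν`:
`(z)_k = z (z + 1) ⋯ (z + k - 1)` and `(z)_{-k} = 1 / ((z - 1) (z - 2) ⋯ (z - k))`, `k ≥ 0`. -/
def pochZ (z : ℂ) (ν : ℤ) : ℂ :=
  if 0 ≤ ν then poch z ν.toNat else (∏ r ∈ range (-ν).toNat, (z - (r + 1)))⁻¹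

/-- The general term of the Lauricella series `F_A^{(n)}(a, b; c; x)`. -/
def lauricellaATerm {n : ℕ} (a : ℂ) (b c x : Fin n → ℂ) (m : Fin n → ℕ) : ℂ :=
  poch a (∑ i, m i) * ∏ i, (poch (b i) (m i) / (poch (c i) (m i) * (m i).factorial) * x i ^ m i)

/-- The Lauricella function `F_A^{(n)}(a, b; c; x)`. -/
def lauricellaA {n : ℕ} (a : ℂ) (b c x : Fin n → ℂ) : ℂ :=
  ∑' m : Fin n → ℕ, lauricellaATerm a b c x m

/-- The general term of `H_A^{(n,p)}(a, b; c; x, y)`, at `(m_1, …, m_n)` and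
`(m_{n+1}, …, m_{n+p}) = (q_1, …, q_p)`. -/
def confluentHATerm {n p : ℕ} (a : ℂ) (b c x : Fin n → ℂ) (y : Fin p → ℂ)
    (mq : (Fin n → ℕ) × (Fin p → ℕ)) : ℂ :=
  pochZ a ((∑ i, (mq.1 i : ℤ)) - ∑ j, (mq.2 j : ℤ)) *
    (∏ i, (poch (b i) (mq.1 i) / (poch (c i) (mq.1 i) * (mq.1 i).factorial) * x i ^ mq.1 i)) *
    ∏ j, (y j ^ mq.2 j / (mq.2 j).factorial)

/-- The confluent hypergeometric function `H_A^{(n,p)}(a, b; c; x, y)` of `n + p` variables. -/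
def confluentHA {n p : ℕ} (a : ℂ) (b c x : Fin n → ℂ) (y : Fin p → ℂ) : ℂ :=
  ∑' mq : (Fin n → ℕ) × (Fin p → ℕ), confluentHATerm a b c x y mq

/-- The general term of the `p`-variable function `₀F_p(d; y)`. -/
def zeroFTerm {p : ℕ} (d : ℂ) (y : Fin p → ℂ) (q : Fin p → ℕ) : ℂ :=
  (poch d (∑ j, q j))⁻¹ * ∏ j, (y j ^ q j / (q j).factorial)

/-- `₀F_p(d; y) = ∑ y_1^{q_1} ⋯ y_p^{q_p} / ((d)_{q_1 + ⋯ + q_p} q_1! ⋯ q_p!)`. -/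
def zeroF {p : ℕ} (d : ℂ) (y : Fin p → ℂ) : ℂ := ∑' q : Fin p → ℕ, zeroFTerm d y q

/-- The general term of the one-variable function `₀F₁(d; z)`. -/
def zeroF1Term (d z : ℂ) (q : ℕ) : ℂ := z ^ q / (poch d q * q.factorial)

/-- `₀F₁(d; z) = ∑ z^q / ((d)_q q!)`. -/
def zeroF1 (d z : ℂ) : ℂ := ∑' q : ℕ, zeroF1Term d z q

/-- `δ_1 + ⋯ + δ_n`, where `δ_i = x_i ∂/∂x_i`. -/
def eulerX {n p : ℕ} (f : (Fin n → ℂ) → (Fin p → ℂ) → ℂ) (x : Fin n → ℂ) (y : Fin p → ℂ) : ℂ :=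
  ∑ i, x i * deriv (fun t => f (Function.update x i t) y) (x i)

/-- `σ_1 + ⋯ + σ_p`, where `σ_j = y_j ∂/∂y_j`. -/
def eulerY {n p : ℕ} (f : (Fin n → ℂ) → (Fin p → ℂ) → ℂ) (x : Fin n → ℂ) (y : Fin p → ℂ) : ℂ :=
  ∑ j, y j * deriv (fun t => f x (Function.update y j t)) (y j)

/-- The shifted factorial `(T)_k = T (T + 1) ⋯ (T + k - 1)` of an operator `T` on functions. -/
def opPoch {n p : ℕ}
    (T : ((Fin n → ℂ) → (Fin p → ℂ) → ℂ) → (Fin n → ℂ) → (Fin p → ℂ) → ℂ) :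
    ℕ → ((Fin n → ℂ) → (Fin p → ℂ) → ℂ) → (Fin n → ℂ) → (Fin p → ℂ) → ℂ
  | 0, f => f
  | k + 1, f => fun x y => T (opPoch T k f) x y + k * opPoch T k f x y

/-- The `k`-th term `(-δ_1 - ⋯ - δ_n)_k (σ_1 + ⋯ + σ_p)_k f / ((h)_k k!)` of the operator series of
`∇̃^{(n,p)}_{x,y}(h)` applied to `f`. -/
def nablaSeriesTerm {n p : ℕ} (h : ℂ) (k : ℕ) (f : (Fin n → ℂ) → (Fin p → ℂ) → ℂ)
    (x : Fin n → ℂ) (y : Fin p → ℂ) : ℂ :=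
  opPoch (fun g x y => -eulerX g x y) k (opPoch eulerY k f) x y / (poch h k * k.factorial)

/-- The symbol `Γ(h) Γ(h + M - N) / (Γ(h + M) Γ(h - N))` of `∇̃^{(n,p)}_{x,y}(h)`. -/
def nablaSymbol (h : ℂ) (M N : ℕ) : ℂ :=
  Complex.Gamma h * Complex.Gamma (h + M - N) / (Complex.Gamma (h + M) * Complex.Gamma (h - N))

/-- `g = ∇̃^{(n,p)}_{x,y}(h) f` on `D`, where `∇̃^{(n,p)}_{x,y}(h)` is the operator
`Γ(h) Γ(h + δ_1 + ⋯ + δ_n - σ_1 - ⋯ - σ_p) / (Γ(h + δ_1 + ⋯ + δ_n) Γ(h - σ_1 - ⋯ - σ_p))`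
acting on functions with a power series: a monomial `x^m y^q` is an eigenvector of every `δ_i` and
`σ_j`, with the eigenvalues `m_i` and `q_j`, hence of the operator, with the eigenvalue
`nablaSymbol h (m_1 + ⋯ + m_n) (q_1 + ⋯ + q_p)`. -/
def IsNablaImage {n p : ℕ} (h : ℂ) (D : Set ((Fin n → ℂ) × (Fin p → ℂ)))
    (f g : (Fin n → ℂ) → (Fin p → ℂ) → ℂ) : Prop :=
  ∃ A : (Fin n → ℕ) × (Fin p → ℕ) → ℂ, ∀ z ∈ D,
    HasSum (fun mq => A mq * ((∏ i, z.1 i ^ mq.1 i) * ∏ j, z.2 j ^ mq.2 j)) (f z.1 z.2) ∧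
    HasSum (fun mq => nablaSymbol h (∑ i, mq.1 i) (∑ j, mq.2 j) * A mq *
      ((∏ i, z.1 i ^ mq.1 i) * ∏ j, z.2 j ^ mq.2 j)) (g z.1 z.2)

/-- The `k`-th term (`k ≥ 1`) of the decomposition of `H_A^{(n,p)}(a, b; c; x, y)`; it is a finite
sum over `1 ≤ l ≤ k` and the multi-indices `i`, `j` with `|i| = k`, `|j| = l`. -/
def decompTerm {n p : ℕ} (a : ℂ) (b c x : Fin n → ℂ) (y : Fin p → ℂ) (k : ℕ) : ℂ :=
  ∑ l ∈ Icc 1 k, ∑ i ∈ piAntidiag (univ : Finset (Fin n)) k,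
    ∑ j ∈ piAntidiag (univ : Finset (Fin p)) l,
      ((k - 1).choose (l - 1) : ℂ) *
        ((-1) ^ (k + l) * k.factorial * (∏ s, poch (b s) (i s)) /
          (poch (1 - a) l * ∏ s, poch (c s) (i s))) *
        (∏ s, (x s ^ i s / (i s).factorial)) * (∏ t, (y t ^ j t / (j t).factorial)) *
        lauricellaA (a + k) (fun s => b s + i s) (fun s => c s + i s) x *
        zeroF (1 - a + l) (-y)

/-- The `k`-th term (`k ≥ 1`) of the decomposition of `H_A^{(n,1)}(a, b; c; x, y)`. -/
def decompTermOne {n : ℕ} (a : ℂ) (b c x : Fin n → ℂ) (y : ℂ) (k : ℕ) : ℂ :=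
  ∑ l ∈ Icc 1 k, ∑ i ∈ piAntidiag (univ : Finset (Fin n)) k,
      ((k - 1).choose (l - 1) : ℂ) *
        ((-1) ^ (k + l) * k.factorial * (∏ s, poch (b s) (i s)) /
          (poch (1 - a) l * ∏ s, poch (c s) (i s))) *
        (∏ s, (x s ^ i s / (i s).factorial)) * (y ^ l / l.factorial) *
        lauricellaA (a + k) (fun s => b s + i s) (fun s => c s + i s) x *
        zeroF1 (1 - a + l) (-y)

/-- `(z)_k = Γ(z + k) / Γ(z)` where the quotient exists. -/
theorem poch_eq_Gamma (z : ℂ) (k : ℕ) (hz : ∀ m : ℕ, z ≠ -m) :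
    poch z k = Complex.Gamma (z + k) / Complex.Gamma z := by
  induction k with
  | zero => simp [poch, Complex.Gamma_ne_zero hz]
  | succ k ih =>
    have h : z + k ≠ 0 := fun h => hz k (eq_neg_of_add_eq_zero_left h)
    have e : z + ((k + 1 : ℕ) : ℂ) = z + k + 1 := by push_cast; ring
    rw [poch, prod_range_succ, e, Complex.Gamma_add_one _ h]
    rw [poch] at ih
    rw [ih]; ring

/-- `(z)_ν = Γ(z + ν) / Γ(z)` where the quotient exists. -/
theorem pochZ_eq_Gamma (z : ℂ) (ν : ℤ) (hz : ∀ m : ℤ, z ≠ m) :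
    pochZ z ν = Complex.Gamma (z + ν) / Complex.Gamma z := by
  have hz' : ∀ m : ℕ, z ≠ -m := fun m h => hz (-m) (by rw [h]; push_cast; ring)
  unfold pochZ
  split_ifs with h
  · obtain ⟨k, rfl⟩ := Int.eq_ofNat_of_zero_le h
    simpa using poch_eq_Gamma z k hz'
  · obtain ⟨k, hk⟩ := Int.eq_ofNat_of_zero_le (show 0 ≤ -ν by omega)
    obtain rfl : ν = -(k : ℤ) := by omega
    have key : ∀ k : ℕ, Complex.Gamma z =
        (∏ r ∈ range k, (z - (r + 1))) * Complex.Gamma (z - k) := by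
      intro k
      induction k with
      | zero => simp
      | succ k ih =>
        have h1 : z - ((k + 1 : ℕ) : ℂ) ≠ 0 := fun h => hz (k + 1 : ℕ) (by
          rw [sub_eq_zero.mp h]; push_cast; ring)
        have h2 := Complex.Gamma_add_one _ h1
        have e : z - ((k + 1 : ℕ) : ℂ) + 1 = z - k := by push_cast; ring
        rw [e] at h2
        rw [ih, h2, prod_range_succ]; push_cast; ring
    have hG : Complex.Gamma (z - k) ≠ 0 := Complex.Gamma_ne_zero fun m h =>
      hz (k - m) (by rw [eq_add_of_sub_eq h]; push_cast; ring)
    have e : z + ((-(k : ℤ) : ℤ) : ℂ) = z - k := by push_cast; ring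
    rw [e, key k, neg_neg, Int.toNat_natCast]
    rw [div_mul_cancel_right₀ hG]

end

open Finset

/-! Since (a)_{M-N} = (a-N)_M (-1)^N / (1-a)_N, summing the series of H_A over m first gives the sum
over q of F_A(a-|q|) times the general term of ₀F_p(1-a; -y). It remains to expand F_A(a-N) so that
N enters only through scalar coefficients. Formally F_A(a) is the average of (1-X)^{-a}, X = ∑ s_i
x_i, for Beta weights on the cube of the s_i, and (1-X)^N = (1 + X/(1-X))^{-N} = ∑_k (-1)^k C(N+k-1,
k) (X/(1-X))^k. The average of (1-X)^{-a} (X/(1-X))^k is `kapSum a b c x k`. The expansion needs |X|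
< |1-X|, that is Re X < 1/2, and the bound on ∑ max(Re x_i, 0) secures this on the whole cube.

Beta weights exist only for Re b_i > 0 and Re(c_i - b_i) > 0. The integral therefore serves only to
prove that `kapSum` decays geometrically in k, and contiguous relations carry the decay to all b, c
(`hasDecay_prod_phi_of_re_pos`, `exists_norm_tsum_kap_le`). The expansion itself comes from
inverting the recurrence `kapSum_add_one_param` among decaying sequences (`hasSum_multichoose`).

The terms of ₀F_p decay faster than any exponential in |q|, so the sums over k and q may be
exchanged (`hasSum_confluentHA`). The resulting series in k is, term by term, both the operator
series (`nablaSeriesTerm_eq`, by evaluating Euler operators on monomials) and the decomposition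
(`decompTerm_eq`, by Vandermonde's identity and shifts of the indices). -/

/-! ### Shifted factorials and their growth -/

theorem poch_zero (z : ℂ) : poch z 0 = 1 := by simp [poch]

theorem poch_succ (z : ℂ) (k : ℕ) : poch z (k + 1) = poch z k * (z + k) := by
  simp [poch, prod_range_succ]

theorem poch_add (z : ℂ) (j k : ℕ) : poch z (j + k) = poch z j * poch (z + j) k := by
  simp only [poch, prod_range_add, Nat.cast_add, add_assoc]

theorem poch_succ' (z : ℂ) (k : ℕ) : poch z (k + 1) = z * poch (z + 1) k := by
  rw [add_comm k 1, poch_add]; simp [poch]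

theorem poch_ne_zero {z : ℂ} (hz : ∀ m : ℕ, z ≠ -m) (k : ℕ) : poch z k ≠ 0 :=
  prod_ne_zero_iff.mpr fun r _ h => hz r (eq_neg_of_add_eq_zero_left h)

theorem poch_one (k : ℕ) : poch 1 k = k.factorial := by
  induction k with
  | zero => simp [poch]
  | succ k ih => rw [poch_succ, ih, Nat.factorial_succ]; push_cast; ring

theorem shift_ne_neg_nat {z : ℂ} (hz : ∀ m : ℕ, z ≠ -m) (k m : ℕ) : z + k ≠ -m := fun h =>
  hz (k + m) (by rw [eq_sub_of_add_eq h]; push_cast; ring)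

theorem exists_le_mul_pow_of_succ_le {u : ℕ → ℝ} (hu : ∀ m, 0 ≤ u m) {η : ℝ} (hη : 1 ≤ η) {N : ℕ}
    (h : ∀ m, N ≤ m → u (m + 1) ≤ η * u m) : ∃ C, 0 ≤ C ∧ ∀ m, u m ≤ C * η ^ m := by
  have h0 : 0 ≤ ∑ i ∈ range (N + 1), u i := sum_nonneg fun i _ => hu i
  refine ⟨∑ i ∈ range (N + 1), u i, h0, fun m => ?_⟩
  have small : ∀ m, m ≤ N → u m ≤ (∑ i ∈ range (N + 1), u i) * η ^ m := fun m hm =>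
    (single_le_sum (f := u) (fun i _ => hu i) (mem_range.mpr (by omega))).trans
      (le_mul_of_one_le_right h0 (one_le_pow₀ hη))
  rcases le_total m N with hm | hm
  · exact small m hm
  · induction m, hm using Nat.le_induction with
    | base => exact small N le_rfl
    | succ m hm ih =>
      calc u (m + 1) ≤ η * u m := h m hm
        _ ≤ η * ((∑ i ∈ range (N + 1), u i) * η ^ m) := by gcongr
        _ = _ := by ring

theorem norm_poch_div_poch_le (b : ℂ) {c : ℂ} (hc : ∀ m : ℕ, c ≠ -m) {η : ℝ} (hη : 1 < η) :
    ∃ C, 0 ≤ C ∧ ∀ m, ‖poch b m / poch c m‖ ≤ C * η ^ m := by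
  -- From this N on, ‖b‖ + m ≤ η (m - ‖c‖), so the ratio of consecutive terms is at most η.
  obtain ⟨N, hN⟩ := exists_nat_ge ((‖b‖ + η * ‖c‖) / (η - 1))
  refine exists_le_mul_pow_of_succ_le (fun m => norm_nonneg _) hη.le (N := N) fun m hm => ?_
  have hm' : (N : ℝ) ≤ m := by exact_mod_cast hm
  have h1 : ‖b‖ + η * ‖c‖ ≤ m * (η - 1) := by
    rw [div_le_iff₀ (by linarith)] at hN
    exact hN.trans (mul_le_mul_of_nonneg_right hm' (by linarith))
  have hb : ‖b + m‖ ≤ ‖b‖ + m := by simpa using norm_add_le b (m : ℂ)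
  have hcm : (m : ℝ) - ‖c‖ ≤ ‖c + m‖ := by
    have := norm_sub_le (c + m) c
    simp only [add_sub_cancel_left, Complex.norm_natCast] at this
    linarith
  have hpos : 0 < ‖c + m‖ := norm_pos_iff.mpr fun h => hc m (eq_neg_of_add_eq_zero_left h)
  rw [poch_succ, poch_succ, mul_div_mul_comm, norm_mul, mul_comm]
  gcongr
  rw [norm_div, div_le_iff₀ hpos]
  nlinarith

theorem norm_poch_le (a : ℂ) {η : ℝ} (hη : 1 < η) :
    ∃ C, 0 ≤ C ∧ ∀ m : ℕ, ‖poch a m‖ ≤ C * η ^ m * m.factorial := by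
  obtain ⟨C, hC, h⟩ := norm_poch_div_poch_le a (c := 1) (fun m h => by
    have := congrArg Complex.re h
    simp only [Complex.one_re, Complex.neg_re, Complex.natCast_re] at this
    have : (0 : ℝ) ≤ m := by positivity
    linarith) hη
  refine ⟨C, hC, fun m => ?_⟩
  have := h m
  rwa [poch_one, norm_div, Complex.norm_natCast, div_le_iff₀ (by positivity)] at this

theorem norm_inv_poch_le {d : ℂ} (hd : ∀ m : ℕ, d ≠ -m) {η : ℝ} (hη : 1 < η) :
    ∃ C, 0 ≤ C ∧ ∀ m : ℕ, ‖(poch d m)⁻¹‖ ≤ C * η ^ m / m.factorial := by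
  obtain ⟨C, hC, h⟩ := norm_poch_div_poch_le 1 hd hη
  refine ⟨C, hC, fun m => ?_⟩
  have := h m
  rw [poch_one, norm_div, Complex.norm_natCast] at this
  rw [le_div_iff₀ (by positivity), norm_inv]
  rw [div_eq_mul_inv] at this; linarith

/-! ### Series over multi-indices, grouped by total degree -/

theorem multinomial_eq {n : ℕ} (r : Fin n → ℂ) (M : ℕ) :
    ∑ m ∈ piAntidiag univ M, (M.factorial : ℂ) * ∏ i, (r i ^ m i / (m i).factorial)
      = (∑ i, r i) ^ M := by
  rw [sum_pow_eq_sum_piAntidiag]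
  refine sum_congr rfl fun m hm => ?_
  have hs : ∑ i, m i = M := (mem_piAntidiag.mp hm).1
  have h := Nat.multinomial_spec univ m
  rw [hs] at h
  have h' : (∏ i, ((m i).factorial : ℂ)) * (Nat.multinomial univ m : ℂ) = M.factorial := by
    exact_mod_cast h
  have hne : (∏ i, ((m i).factorial : ℂ)) ≠ 0 :=
    prod_ne_zero_iff.mpr fun i _ => by exact_mod_cast (m i).factorial_ne_zero
  rw [prod_div_distrib, ← h']
  field_simp

theorem tsum_eq_tsum_piAntidiag {n : ℕ} {f : (Fin n → ℕ) → ℂ} (hf : Summable f) :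
    ∑' m, f m = ∑' M : ℕ, ∑ m ∈ piAntidiag univ M, f m := by
  rw [← (Equiv.sigmaFiberEquiv fun m : Fin n → ℕ => ∑ i, m i).tsum_eq f,
    Summable.tsum_sigma (f := fun c => f (Equiv.sigmaFiberEquiv _ c))
      ((Equiv.summable_iff _).mpr hf)]
  refine tsum_congr fun M => ?_
  rw [← Finset.tsum_subtype (piAntidiag univ M) f]
  have he : ∀ m : Fin n → ℕ, m ∈ piAntidiag univ M ↔ ∑ i, m i = M := by simp
  exact (Equiv.tsum_eq (Equiv.subtypeEquivRight he)
    fun c => f ((Equiv.sigmaFiberEquiv fun m : Fin n → ℕ => ∑ i, m i) ⟨M, c⟩)).symm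

theorem summable_of_summable_piAntidiag {n : ℕ} {f : (Fin n → ℕ) → ℝ} (hf : ∀ m, 0 ≤ f m)
    (h : Summable fun M : ℕ => ∑ m ∈ piAntidiag univ M, f m) : Summable f := by
  refine summable_of_sum_le (c := ∑' M : ℕ, ∑ m ∈ piAntidiag univ M, f m) hf fun s => ?_
  let g : (Fin n → ℕ) → ℕ := fun m => ∑ i, m i
  calc ∑ m ∈ s, f m = ∑ M ∈ s.image g, ∑ m ∈ s with g m = M, f m :=
        (sum_fiberwise_of_maps_to (fun m hm => mem_image_of_mem g hm) f).symm
    _ ≤ ∑ M ∈ s.image g, ∑ m ∈ piAntidiag univ M, f m :=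
        sum_le_sum fun M _ => sum_le_sum_of_subset_of_nonneg
          (fun m hm => by simpa using (mem_filter.mp hm).2) fun m _ _ => hf m
    _ ≤ _ := h.sum_le_tsum _ fun M _ => sum_nonneg fun m _ => hf m

theorem summable_multinomial {n : ℕ} {w : ℕ → ℝ} (hw : ∀ M, 0 ≤ w M) {r : Fin n → ℝ}
    (hr : ∀ i, 0 ≤ r i) (h : Summable fun M => w M * (∑ i, r i) ^ M) :
    Summable fun m : Fin n → ℕ =>
      w (∑ i, m i) * ((∑ i, m i).factorial * ∏ i, (r i ^ m i / (m i).factorial)) := by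
  refine summable_of_summable_piAntidiag (fun m => ?_) (h.congr fun M => ?_)
  · have := hw (∑ i, m i)
    have : 0 ≤ ∏ i, (r i ^ m i / (m i).factorial) :=
      prod_nonneg fun i _ => div_nonneg (pow_nonneg (hr i) _) (by positivity)
    positivity
  · have h1 := multinomial_eq (fun i => (r i : ℂ)) M
    have h2 : ∑ m ∈ piAntidiag univ M, (M.factorial : ℝ) * ∏ i, (r i ^ m i / (m i).factorial)
      = (∑ i, r i) ^ M := by exact_mod_cast h1
    rw [← h2, mul_sum]
    refine sum_congr rfl fun m hm => ?_
    have hs : ∑ i, m i = M := (mem_piAntidiag.mp hm).1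
    rw [hs]

theorem tsum_multinomial {n : ℕ} {w : ℕ → ℂ} {r : Fin n → ℂ}
    (h : Summable fun M => ‖w M‖ * (∑ i, ‖r i‖) ^ M) :
    (Summable fun m : Fin n → ℕ =>
      ‖w (∑ i, m i) * ((∑ i, m i).factorial * ∏ i, (r i ^ m i / (m i).factorial))‖) ∧
    ∑' m : Fin n → ℕ, w (∑ i, m i) * ((∑ i, m i).factorial * ∏ i, (r i ^ m i / (m i).factorial))
      = ∑' M, w M * (∑ i, r i) ^ M := by
  have h1 : Summable fun m : Fin n → ℕ =>
      ‖w (∑ i, m i) * ((∑ i, m i).factorial * ∏ i, (r i ^ m i / (m i).factorial))‖ := by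
    refine (summable_multinomial (fun M => norm_nonneg (w M)) (fun i => norm_nonneg (r i))
      h).congr fun m => ?_
    simp [norm_prod, norm_pow]
  refine ⟨h1, ?_⟩
  rw [tsum_eq_tsum_piAntidiag h1.of_norm]
  refine tsum_congr fun M => ?_
  rw [← multinomial_eq, mul_sum]
  refine sum_congr rfl fun m hm => ?_
  have hs : ∑ i, m i = M := (mem_piAntidiag.mp hm).1
  rw [hs]

/-! ### Weights with exponential generating function X^k (1-X)^{-a-k} -/

/-- `M! / (M - k)! (a + k)_{M - k}`, which is `0` for `M < k`. -/
noncomputable def kap (a : ℂ) (k M : ℕ) : ℂ := (M.descFactorial k : ℂ) * poch (a + k) (M - k)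

theorem kap_zero (a : ℂ) (M : ℕ) : kap a 0 M = poch a M := by simp [kap]

theorem kap_of_lt (a : ℂ) {k M : ℕ} (h : M < k) : kap a k M = 0 := by
  simp [kap, Nat.descFactorial_of_lt h]

theorem kap_add_left (a : ℂ) (k j : ℕ) :
    kap a k (k + j) = ((k + j).factorial / j.factorial : ℂ) * poch (a + k) j := by
  have h := Nat.factorial_mul_descFactorial (Nat.le_add_right k j)
  rw [Nat.add_sub_cancel_left] at h
  have h' : (j.factorial : ℂ) * ((k + j).descFactorial k : ℂ) = (k + j).factorial := by
    exact_mod_cast h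
  have hj : (j.factorial : ℂ) ≠ 0 := by exact_mod_cast j.factorial_ne_zero
  rw [kap, Nat.add_sub_cancel_left, ← h']
  field_simp

/-- Compare coefficients in X^k (1-X)^{-a-1-k} = X^k (1-X)^{-a-k} + X^{k+1} (1-X)^{-a-k-1}. -/
theorem kap_add_one_param (a : ℂ) (k M : ℕ) : kap (a + 1) k M = kap a k M + kap a (k + 1) M := by
  rcases lt_trichotomy M k with h | rfl | h
  · simp [kap_of_lt, h, Nat.lt_succ_of_lt h]
  · rw [kap_of_lt a (Nat.lt_succ_self M)]; simp [kap, poch]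
  · obtain ⟨j, rfl⟩ := Nat.exists_eq_add_of_le (Nat.succ_le_of_lt h)
    have e1 : k.succ + j = k + (j + 1) := by omega
    rw [show kap a (k + 1) (k.succ + j) = kap a (k + 1) (k + 1 + j) from rfl, kap_add_left, e1,
      kap_add_left, kap_add_left, poch_succ, poch_succ', Nat.factorial_succ j]
    have hj : (j.factorial : ℂ) ≠ 0 := by exact_mod_cast j.factorial_ne_zero
    have hj' : (j : ℂ) + 1 ≠ 0 := by exact_mod_cast j.succ_ne_zero
    push_cast
    rw [show a + 1 + (k : ℂ) = a + k + 1 by ring, show a + ((k : ℂ) + 1) = a + k + 1 by ring]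
    field_simp
    ring

/-- Compare coefficients in the derivative of X^k (1-X)^{-a-k}. At k = 0 the truncated `k - 1` is
harmless because of the factor k. -/
theorem kap_succ (a : ℂ) (k M : ℕ) :
    kap a k (M + 1) = (a + k) * kap (a + 1) k M + k * kap (a + 1) (k - 1) M := by
  rcases k with _ | k
  · simp [kap, poch_succ']
  rw [Nat.add_sub_cancel]
  rcases lt_trichotomy M k with h | rfl | h
  · simp [kap_of_lt, h, Nat.lt_succ_of_lt h]
  · rw [kap_of_lt (a + 1) (Nat.lt_succ_self M)]
    have h := Nat.factorial_mul_descFactorial (Nat.le_succ M)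
    rw [Nat.succ_eq_add_one, Nat.add_sub_cancel_left, Nat.factorial_one, one_mul] at h
    simp [kap, poch, Nat.descFactorial_self, h, Nat.factorial_succ]
  · obtain ⟨j, rfl⟩ := Nat.exists_eq_add_of_le (Nat.succ_le_of_lt h)
    have e1 : k.succ + j = k + (j + 1) := by omega
    rw [show k.succ + j + 1 = (k + 1) + (j + 1) from rfl, kap_add_left,
      show kap (a + 1) (k + 1) (k.succ + j) = kap (a + 1) (k + 1) (k + 1 + j) from rfl,
      kap_add_left, e1, kap_add_left, Nat.factorial_succ j]
    have hj : (j.factorial : ℂ) ≠ 0 := by exact_mod_cast j.factorial_ne_zero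
    have hj' : (j : ℂ) + 1 ≠ 0 := by exact_mod_cast j.succ_ne_zero
    have e3 : k + 1 + (j + 1) = k + (j + 1) + 1 := by omega
    rw [e3, Nat.factorial_succ (k + (j + 1)), poch_succ' (a + ↑(k + 1)) j,
      show a + 1 + (k : ℂ) = a + ↑(k + 1) by push_cast; ring, poch_succ' (a + ↑(k + 1)) j]
    push_cast
    rw [show a + 1 + ((k : ℂ) + 1) = a + (k + 1) + 1 by ring]
    field_simp
    ring

theorem exists_one_lt_mul_lt {σ : ℝ} (h0 : 0 ≤ σ) (h1 : σ < 1) :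
    ∃ η : ℝ, 1 < η ∧ η * (η * σ) < 1 := by
  -- With this η, η²σ = 4σ/(1+σ)² < 1 because (1-σ)² > 0.
  refine ⟨2 / (1 + σ), ?_, ?_⟩
  · rw [lt_div_iff₀ (by linarith)]; linarith
  · have e : 2 / (1 + σ) * (2 / (1 + σ) * σ) = 4 * σ / (1 + σ) ^ 2 := by field_simp; ring
    rw [e, div_lt_one (by positivity)]
    nlinarith [sq_pos_of_pos (sub_pos.mpr h1)]

/-! ### Absolute convergence for |x_1| + ⋯ + |x_n| < 1 -/

/-- The coefficient `(b)_m x^m / ((c)_m m!)` of the confluent series `₁F₁(b; c; x)`. -/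
noncomputable def phi (b c x : ℂ) (m : ℕ) : ℂ := poch b m / (poch c m * m.factorial) * x ^ m

theorem norm_prod_phi_le {n : ℕ} (b : Fin n → ℂ) {c : Fin n → ℂ} (hc : ∀ i, ∀ m : ℕ, c i ≠ -m)
    (x : Fin n → ℂ) {η : ℝ} (hη : 1 < η) :
    ∃ C, 0 ≤ C ∧ ∀ m : Fin n → ℕ, ‖∏ i, phi (b i) (c i) (x i) (m i)‖
      ≤ C * ∏ i, ((η * ‖x i‖) ^ m i / (m i).factorial) := by
  choose C hC h using fun i => norm_poch_div_poch_le (b i) (hc i) hη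
  refine ⟨∏ i, C i, prod_nonneg fun i _ => hC i, fun m => ?_⟩
  rw [norm_prod, ← prod_mul_distrib]
  refine prod_le_prod (fun i _ => norm_nonneg _) fun i _ => ?_
  rw [phi, ← div_div, norm_mul, norm_div, norm_pow, Complex.norm_natCast, mul_pow]
  calc ‖poch (b i) (m i) / poch (c i) (m i)‖ / (m i).factorial * ‖x i‖ ^ m i
      ≤ C i * η ^ m i / (m i).factorial * ‖x i‖ ^ m i := by gcongr; exact h i (m i)
    _ = _ := by ring

theorem norm_kap_le (a : ℂ) (k : ℕ) {η : ℝ} (hη : 1 < η) :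
    ∃ C, 0 ≤ C ∧ ∀ M : ℕ, ‖kap a k M‖ ≤ C * η ^ M * M.factorial := by
  obtain ⟨C, hC, h⟩ := norm_poch_le (a + k) hη
  refine ⟨C, hC, fun M => ?_⟩
  rcases lt_or_ge M k with hM | hM
  · rw [kap_of_lt a hM, norm_zero]
    have : 0 < η := by linarith
    positivity
  · obtain ⟨j, rfl⟩ := Nat.exists_eq_add_of_le hM
    rw [kap_add_left, norm_mul, norm_div, Complex.norm_natCast, Complex.norm_natCast]
    calc ((k + j).factorial / j.factorial : ℝ) * ‖poch (a + k) j‖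
        ≤ (k + j).factorial / j.factorial * (C * η ^ j * j.factorial) := by gcongr; exact h j
      _ = C * η ^ j * (k + j).factorial := by field_simp
      _ ≤ C * η ^ (k + j) * (k + j).factorial := by
        have := pow_le_pow_right₀ hη.le (Nat.le_add_left j k)
        gcongr

/-- One factor η is spent on the quotients (b_i)_m/(c_i)_m, the other is kept as a weight. By the
multinomial theorem the majorant is geometric with ratio η² ∑ ‖x i‖ < 1. -/
theorem exists_summable_factorial_mul_phi {n : ℕ} (b : Fin n → ℂ) {c : Fin n → ℂ}
    (hc : ∀ i, ∀ m : ℕ, c i ≠ -m) {x : Fin n → ℂ} (hx : ∑ i, ‖x i‖ < 1) :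
    ∃ η : ℝ, 1 < η ∧ Summable fun m : Fin n → ℕ =>
      η ^ (∑ i, m i) * (∑ i, m i).factorial * ‖∏ i, phi (b i) (c i) (x i) (m i)‖ := by
  obtain ⟨η, hη, hη2⟩ := exists_one_lt_mul_lt (sum_nonneg fun i _ => norm_nonneg (x i)) hx
  obtain ⟨C', hC', h'⟩ := norm_prod_phi_le b hc x hη
  have hη0 : 0 < η := by linarith
  have hs : 0 ≤ ∑ i, ‖x i‖ := sum_nonneg fun i _ => norm_nonneg (x i)
  have key := summable_multinomial (w := fun M => C' * η ^ M) (r := fun i => η * ‖x i‖)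
    (fun M => by positivity) (fun i => by positivity) (by
      simp_rw [← mul_sum, mul_assoc C', ← mul_pow]
      exact (summable_geometric_of_lt_one (by positivity) hη2).mul_left _)
  refine ⟨η, hη, key.of_nonneg_of_le (fun m => by positivity) fun m => ?_⟩
  refine (mul_le_mul_of_nonneg_left (h' m) (by positivity)).trans (le_of_eq ?_)
  ring

theorem summable_of_norm_le_factorial {n : ℕ} (b : Fin n → ℂ) {c : Fin n → ℂ}
    (hc : ∀ i, ∀ m : ℕ, c i ≠ -m) {x : Fin n → ℂ} (hx : ∑ i, ‖x i‖ < 1) {w : ℕ → ℂ}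
    (hw : ∀ η : ℝ, 1 < η → ∃ C, 0 ≤ C ∧ ∀ M : ℕ, ‖w M‖ ≤ C * η ^ M * M.factorial) :
    Summable fun m : Fin n → ℕ => ‖w (∑ i, m i) * ∏ i, phi (b i) (c i) (x i) (m i)‖ := by
  obtain ⟨η, hη, hs⟩ := exists_summable_factorial_mul_phi b hc hx
  obtain ⟨C, hC, h⟩ := hw η hη
  refine (hs.mul_left C).of_nonneg_of_le (fun m => norm_nonneg _) fun m => ?_
  rw [norm_mul]
  refine (mul_le_mul_of_nonneg_right (h _) (norm_nonneg _)).trans (le_of_eq ?_)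
  ring

theorem summable_norm_kap_mul_phi {n : ℕ} (a : ℂ) (k : ℕ) (b : Fin n → ℂ) {c : Fin n → ℂ}
    (hc : ∀ i, ∀ m : ℕ, c i ≠ -m) {x : Fin n → ℂ} (hx : ∑ i, ‖x i‖ < 1) :
    Summable fun m : Fin n → ℕ => ‖kap a k (∑ i, m i) * ∏ i, phi (b i) (c i) (x i) (m i)‖ :=
  summable_of_norm_le_factorial b hc hx fun _ hη => norm_kap_le a k hη

/-! ### Decay in k and its stability under contiguous relations -/

/-- Geometric decay, up to a polynomial factor, of the sums `∑ M! / (M - k)! (a + k)_{M - k} u_m`,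
`M = |m|`, for every `a`. -/
def HasDecay {n : ℕ} (θ : ℝ) (u : (Fin n → ℕ) → ℂ) : Prop :=
  (∀ a k, Summable fun m => kap a k (∑ i, m i) * u m) ∧
  ∀ a, ∃ (C : ℝ) (D : ℕ), ∀ k : ℕ,
    ‖∑' m, kap a k (∑ i, m i) * u m‖ ≤ C * ((k : ℝ) + 1) ^ D * θ ^ k

theorem poly_mul_le {C θ : ℝ} (hθ : 0 ≤ θ) {D E : ℕ} (h : D ≤ E) (k : ℕ) :
    C * ((k : ℝ) + 1) ^ D * θ ^ k ≤ |C| * ((k : ℝ) + 1) ^ E * θ ^ k := by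
  have h1 : ((k : ℝ) + 1) ^ D ≤ ((k : ℝ) + 1) ^ E :=
    pow_le_pow_right₀ (by linarith [(Nat.cast_nonneg k : (0 : ℝ) ≤ k)]) h
  have := le_abs_self C
  gcongr

namespace HasDecay

variable {n : ℕ} {θ : ℝ} {u v : (Fin n → ℕ) → ℂ}

theorem add (hθ : 0 ≤ θ) (hu : HasDecay θ u) (hv : HasDecay θ v) :
    HasDecay θ fun m => u m + v m := by
  refine ⟨fun a k => by simpa only [mul_add] using (hu.1 a k).add (hv.1 a k), fun a => ?_⟩
  obtain ⟨C, D, h⟩ := hu.2 a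
  obtain ⟨C', D', h'⟩ := hv.2 a
  refine ⟨|C| + |C'|, max D D', fun k => ?_⟩
  simp only [mul_add]
  rw [(hu.1 a k).tsum_add (hv.1 a k)]
  refine (norm_add_le _ _).trans ?_
  have h1 := (h k).trans (poly_mul_le hθ (le_max_left D D') k)
  have h2 := (h' k).trans (poly_mul_le hθ (le_max_right D D') k)
  linarith

theorem const_mul (hu : HasDecay θ u) (t : ℂ) : HasDecay θ fun m => t * u m := by
  have e : ∀ (a : ℂ) (k : ℕ) (m : Fin n → ℕ),
      kap a k (∑ i, m i) * (t * u m) = t * (kap a k (∑ i, m i) * u m) := fun a k m => by ring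
  refine ⟨fun a k => by simpa only [e] using (hu.1 a k).mul_left t, fun a => ?_⟩
  obtain ⟨C, D, h⟩ := hu.2 a
  refine ⟨‖t‖ * C, D, fun k => ?_⟩
  simp only [e]
  rw [tsum_mul_left, norm_mul, mul_assoc ‖t‖, mul_assoc ‖t‖]
  gcongr
  exact h k

end HasDecay

/-- Multiplication of a generating function by the `i`-th variable. -/
def shiftAt {n : ℕ} (i : Fin n) (u : (Fin n → ℕ) → ℂ) (m : Fin n → ℕ) : ℂ :=
  if m i = 0 then 0 else u (m - Pi.single i 1)

theorem sum_add_single {n : ℕ} (i : Fin n) (m : Fin n → ℕ) :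
    ∑ j, (m + Pi.single i 1 : Fin n → ℕ) j = ∑ j, m j + 1 := by
  simp [sum_add_distrib]

theorem shiftAt_add_single {n : ℕ} (i : Fin n) (u : (Fin n → ℕ) → ℂ) (m : Fin n → ℕ) :
    shiftAt i u (m + Pi.single i 1) = u m := by
  simp [shiftAt]

theorem shiftAt_eq_zero {n : ℕ} (i : Fin n) (u : (Fin n → ℕ) → ℂ) {m : Fin n → ℕ}
    (hm : m ∉ Set.range fun m : Fin n → ℕ => m + Pi.single i 1) : shiftAt i u m = 0 := by
  rw [shiftAt, if_pos]
  by_contra h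
  refine hm ⟨m - Pi.single i 1, ?_⟩
  ext j
  rcases eq_or_ne j i with rfl | hj
  · simp; omega
  · simp [hj]

/-- By `kap_succ`, a shift in m replaces a by a + 1 and brings in the factors a + k and k. This is
why decay is required for every a at once and only up to a polynomial factor. -/
theorem HasDecay.shiftAt {n : ℕ} {θ : ℝ} (hθ : 0 < θ) {u : (Fin n → ℕ) → ℂ} (hu : HasDecay θ u)
    (i : Fin n) : HasDecay θ (shiftAt i u) := by
  have inj : Function.Injective fun m : Fin n → ℕ => m + Pi.single i 1 :=
    add_left_injective _
  have zero : ∀ (a : ℂ) (k : ℕ) (m : Fin n → ℕ),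
      m ∉ Set.range (fun m : Fin n → ℕ => m + Pi.single i 1) →
      kap a k (∑ j, m j) * _root_.shiftAt i u m = 0 := fun a k m hm => by
    rw [shiftAt_eq_zero i u hm, mul_zero]
  have e : ∀ (a : ℂ) (k : ℕ) (m : Fin n → ℕ),
      kap a k (∑ j, (m + Pi.single i 1 : Fin n → ℕ) j) * _root_.shiftAt i u (m + Pi.single i 1)
      = (a + k) * (kap (a + 1) k (∑ j, m j) * u m)
        + k * (kap (a + 1) (k - 1) (∑ j, m j) * u m) := fun a k m => by
    rw [shiftAt_add_single, sum_add_single, kap_succ]; ring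
  refine ⟨fun a k => ?_, fun a => ?_⟩
  · rw [← inj.summable_iff (zero a k)]
    exact (((hu.1 (a + 1) k).mul_left (a + k)).add ((hu.1 (a + 1) (k - 1)).mul_left (k : ℂ))).congr
      fun m => (e a k m).symm
  obtain ⟨C, D, h⟩ := hu.2 (a + 1)
  -- The first summand pays for a + k; the second for k and for θ^{k-1} = θ^k / θ.
  refine ⟨(‖a‖ + 1) * |C| + |C| / θ, D + 1, fun k => ?_⟩
  have ht : ∑' m, kap a k (∑ j, m j) * _root_.shiftAt i u m
      = (a + k) * ∑' m, kap (a + 1) k (∑ j, m j) * u m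
        + k * ∑' m, kap (a + 1) (k - 1) (∑ j, m j) * u m := by
    rw [← inj.tsum_eq (Function.support_subset_iff'.mpr (zero a k)), ← tsum_mul_left,
      ← tsum_mul_left,
      ← ((hu.1 (a + 1) k).mul_left _).tsum_add ((hu.1 (a + 1) (k - 1)).mul_left _)]
    exact tsum_congr fun m => e a k m
  rw [ht, add_mul _ _ (((k : ℝ) + 1) ^ (D + 1)), add_mul _ _ (θ ^ k)]
  refine (norm_add_le _ _).trans (add_le_add ?_ ?_)
  · rw [norm_mul]
    have h1 : ‖a + k‖ ≤ (‖a‖ + 1) * ((k : ℝ) + 1) := by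
      have := norm_add_le a (k : ℂ)
      rw [Complex.norm_natCast] at this
      nlinarith [norm_nonneg a, (Nat.cast_nonneg k : (0 : ℝ) ≤ k)]
    calc _ ≤ ((‖a‖ + 1) * ((k : ℝ) + 1)) * (|C| * ((k : ℝ) + 1) ^ D * θ ^ k) := by
          gcongr
          exact (h k).trans (poly_mul_le hθ.le le_rfl k)
      _ = _ := by ring
  · rcases k with _ | k
    · simp; positivity
    · rw [norm_mul, Complex.norm_natCast, Nat.add_sub_cancel]
      calc _ ≤ (((k + 1 : ℕ) : ℝ) + 1) * (|C| * (((k + 1 : ℕ) : ℝ) + 1) ^ D * θ ^ k) := by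
            gcongr
            · linarith
            · refine (h k).trans ((poly_mul_le hθ.le le_rfl k).trans ?_)
              gcongr
              simp
        _ = _ := by field_simp; ring

theorem phi_zero (b c x : ℂ) : phi b c x 0 = 1 := by simp [phi, poch]

/-- Both pairs on the right, (b, c+1) and (b+1, c+2), have c - b larger by one, and Re b does not
decrease. -/
theorem phi_eq_add {c : ℂ} (hc : ∀ m : ℕ, c ≠ -m) (b x : ℂ) (m : ℕ) :
    phi b c x m = phi b (c + 1) x m
      + b / (c * (c + 1)) * x * if m = 0 then 0 else phi (b + 1) (c + 2) x (m - 1) := by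
  rcases m with _ | m
  · simp [phi_zero]
  have h0 : c ≠ 0 := by simpa using hc 0
  have h1 : c + 1 ≠ 0 := fun h => hc 1 (by simpa using eq_neg_of_add_eq_zero_left h)
  have h2 : poch (c + 2) m ≠ 0 := poch_ne_zero (by simpa using shift_ne_neg_nat hc 2) m
  have h3 : c + 1 + m ≠ 0 := fun h => hc (m + 1) (by
    push_cast; exact eq_neg_of_add_eq_zero_left (by rw [← h]; ring))
  have hf : (m.factorial : ℂ) ≠ 0 := by exact_mod_cast m.factorial_ne_zero
  have hm : (m : ℂ) + 1 ≠ 0 := by exact_mod_cast m.succ_ne_zero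
  have e1 : poch c (m + 1) * (c + 1 + m) = c * (c + 1) * poch (c + 2) m := by
    have := poch_succ c (m + 1)
    rw [poch_succ' c, poch_succ' (c + 1), show c + 1 + 1 = c + 2 by ring] at this
    push_cast at this
    rw [mul_assoc c, this]; ring
  have e2 : poch c (m + 1) = c * (c + 1) * poch (c + 2) m / (c + 1 + m) := by
    rw [eq_div_iff h3, e1]
  simp only [phi, Nat.succ_ne_zero, if_false, Nat.add_sub_cancel]
  rw [poch_succ' b, e2, poch_succ' (c + 1), show c + 1 + 1 = c + 2 by ring, Nat.factorial_succ]
  push_cast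
  field_simp
  ring

/-- Coefficient form of Kummer's relation (c-b-1) F(b) = -(2b+2-c+x) F(b+1) + (b+1) F(b+2) for F(b)
= ₁F₁(b; c; x). It trades a larger Re b for a smaller Re(c-b). -/
theorem phi_contiguous {c : ℂ} (hc : ∀ m : ℕ, c ≠ -m) (b x : ℂ) (m : ℕ) :
    (c - b - 1) * phi b c x m = -(2 * b + 2 - c) * phi (b + 1) c x m
      + -x * (if m = 0 then 0 else phi (b + 1) c x (m - 1)) + (b + 1) * phi (b + 2) c x m := by
  rcases m with _ | m
  · simp [phi_zero]; ring
  have h2 : poch c m ≠ 0 := poch_ne_zero hc m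
  have h3 : c + m ≠ 0 := fun h => hc m (eq_neg_of_add_eq_zero_left h)
  have hf : (m.factorial : ℂ) ≠ 0 := by exact_mod_cast m.factorial_ne_zero
  have hm : (m : ℂ) + 1 ≠ 0 := by exact_mod_cast m.succ_ne_zero
  have e1 : (b + 1) * poch (b + 2) (m + 1) = poch (b + 1) m * (b + 1 + m) * (b + 2 + m) := by
    rw [show b + 2 = b + 1 + 1 by ring, ← poch_succ', poch_succ, poch_succ]
    push_cast; ring
  simp only [phi, Nat.succ_ne_zero, if_false, Nat.add_sub_cancel]
  rw [show ∀ X Y : ℂ, (b + 1) * (poch (b + 2) (m + 1) / X * Y)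
      = ((b + 1) * poch (b + 2) (m + 1)) / X * Y from fun X Y => by ring, e1,
    poch_succ' b, poch_succ (b + 1), poch_succ c, Nat.factorial_succ]
  push_cast
  field_simp
  ring

theorem HasDecay.phi_of_re_pos {n : ℕ} {θ : ℝ} (hθ : 0 < θ) (i : Fin n) {ρ : (Fin n → ℕ) → ℂ}
    (hρ : ∀ m, ρ (m + Pi.single i 1) = ρ m) (x : ℂ)
    (H : ∀ b c : ℂ, 0 < b.re → 0 < (c - b).re → HasDecay θ fun m => phi b c x (m i) * ρ m)
    (b : ℂ) {c : ℂ} (hc : ∀ m : ℕ, c ≠ -m) : HasDecay θ fun m => phi b c x (m i) * ρ m := by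
  have hshift : ∀ b c m, _root_.shiftAt i (fun m => phi b c x (m i) * ρ m) m
      = (if m i = 0 then 0 else phi b c x (m i - 1)) * ρ m := fun b c m => by
    rw [_root_.shiftAt]
    split_ifs with h
    · simp
    · have e : m - Pi.single i 1 + Pi.single i 1 = m := by
        ext j
        rcases eq_or_ne j i with rfl | hj
        · simp; omega
        · simp [hj]
      rw [← hρ (m - Pi.single i 1), e]
      simp
  -- Lower Re b by `phi_contiguous`. Each step calls on b + 2 with the same c, so it costs 2 in Re(c
  -- - b), whence the bound 2N; that bound also makes the divisor c - b - 1 nonzero.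
  have lower : ∀ N : ℕ, ∀ b c : ℂ, -(N : ℝ) < b.re → 2 * (N : ℝ) < (c - b).re →
      HasDecay θ fun m => phi b c x (m i) * ρ m := by
    intro N
    induction N with
    | zero => intro b c hb hbc; exact H b c (by simpa using hb) (by simpa using hbc)
    | succ N ih =>
      intro b c hb hbc
      push_cast at hb hbc
      rw [Complex.sub_re] at hbc
      have hN : (0 : ℝ) ≤ N := N.cast_nonneg
      have hc' : ∀ m : ℕ, c ≠ -m := fun m h => by
        have h1 := congrArg Complex.re h
        rw [Complex.neg_re, Complex.natCast_re] at h1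
        have : (0 : ℝ) ≤ m := m.cast_nonneg
        linarith
      have hne : c - b - 1 ≠ 0 := fun h => by
        have := congrArg Complex.re h
        simp only [Complex.sub_re, Complex.one_re, Complex.zero_re] at this
        linarith
      have h1 := ih (b + 1) c (by simp; linarith) (by simp; linarith)
      have h2 := ih (b + 2) c (by simp; linarith) (by simp; linarith)
      have h3 := (((h1.const_mul (-(2 * b + 2 - c))).add hθ.le
        ((h1.shiftAt hθ i).const_mul (-x))).add hθ.le (h2.const_mul (b + 1))).const_mul
          (c - b - 1)⁻¹
      convert! h3 using 2 with m
      rw [hshift, eq_inv_mul_iff_mul_eq₀ hne, ← mul_assoc, phi_contiguous hc']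
      ring
  obtain ⟨N, hN⟩ := exists_nat_gt (-b.re)
  -- With N fixed, `phi_eq_add` removes the lower bound on Re(c - b) one unit at a time.
  have raise : ∀ J : ℕ, ∀ b c : ℂ, (∀ m : ℕ, c ≠ -m) → -(N : ℝ) < b.re →
      2 * (N : ℝ) - J < (c - b).re → HasDecay θ fun m => phi b c x (m i) * ρ m := by
    intro J
    induction J with
    | zero => intro b c _ hb hbc; exact lower N b c hb (by simpa using hbc)
    | succ J ih =>
      intro b c hc hb hbc
      push_cast at hbc
      rw [Complex.sub_re] at hbc
      have h1 := ih b (c + 1) (by simpa using shift_ne_neg_nat hc 1) hb (by simp; linarith)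
      have h2 := ih (b + 1) (c + 2) (by simpa using shift_ne_neg_nat hc 2)
        (by simp; linarith) (by simp; linarith)
      have h3 := h1.add hθ.le ((h2.shiftAt hθ i).const_mul (b / (c * (c + 1)) * x))
      convert! h3 using 2 with m
      rw [hshift, phi_eq_add hc]
      ring
  obtain ⟨J, hJ⟩ := exists_nat_gt (2 * (N : ℝ) - (c - b).re)
  exact raise J b c hc (by linarith) (by linarith)

/-- The parameters are freed one coordinate at a time, the other factors playing the role of ρ in
`HasDecay.phi_of_re_pos`. The set s in the induction holds the coordinates already free of
positivity conditions. -/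
theorem hasDecay_prod_phi_of_re_pos {n : ℕ} {θ : ℝ} (hθ : 0 < θ) (x : Fin n → ℂ)
    (H : ∀ b c : Fin n → ℂ, (∀ i, 0 < (b i).re) → (∀ i, 0 < (c i - b i).re) →
      HasDecay θ fun m => ∏ i, phi (b i) (c i) (x i) (m i))
    (b : Fin n → ℂ) {c : Fin n → ℂ} (hc : ∀ i, ∀ m : ℕ, c i ≠ -m) :
    HasDecay θ fun m => ∏ i, phi (b i) (c i) (x i) (m i) := by
  suffices h : ∀ s : Finset (Fin n), ∀ b c : Fin n → ℂ, (∀ i, ∀ m : ℕ, c i ≠ -m) →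
      (∀ i, i ∉ s → 0 < (b i).re ∧ 0 < (c i - b i).re) →
      HasDecay θ fun m => ∏ i, phi (b i) (c i) (x i) (m i) from
    h univ b c hc fun i hi => absurd (mem_univ i) hi
  intro s
  induction s using Finset.induction_on with
  | empty => intro b c _ h; exact H b c (fun i => (h i (by simp)).1) fun i => (h i (by simp)).2
  | insert i s hi ih =>
    intro b c hc h
    have split : ∀ (b c : Fin n → ℂ) (m : Fin n → ℕ), ∏ j, phi (b j) (c j) (x j) (m j)
        = phi (b i) (c i) (x i) (m i) * ∏ j ∈ univ.erase i, phi (b j) (c j) (x j) (m j) :=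
      fun b c m => (mul_prod_erase univ _ (mem_univ i)).symm
    simp only [split]
    refine HasDecay.phi_of_re_pos hθ i (fun m => ?_) (x i) (fun β γ hβ hγ => ?_) (b i) (hc i)
    · refine prod_congr rfl fun j hj => ?_
      simp [(mem_erase.mp hj).1]
    · have hγ' : ∀ m : ℕ, γ ≠ -m := fun m h => by
        have h1 := congrArg Complex.re h
        rw [Complex.neg_re, Complex.natCast_re] at h1
        rw [Complex.sub_re] at hγ
        have : (0 : ℝ) ≤ m := m.cast_nonneg
        linarith
      have := ih (Function.update b i β) (Function.update c i γ) (fun j => by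
        rcases eq_or_ne j i with rfl | hj
        · simpa using hγ'
        · simpa [hj] using hc j) (fun j hj => by
        rcases eq_or_ne j i with rfl | hj'
        · simpa [-Complex.sub_re] using And.intro hβ hγ
        · simpa [hj'] using h j (by simp [hj', hj]))
      convert! this using 2 with m
      rw [split, Function.update_self, Function.update_self]
      congr 1
      refine prod_congr rfl fun j hj => ?_
      simp [(mem_erase.mp hj).1]

/-! ### Decay by Euler's Beta integral -/

open MeasureTheory in
theorem exists_beta_moments {b c : ℂ} (hb : 0 < b.re) (hc : 0 < (c - b).re) :
    ∃ w : ℝ → ℂ, ∀ m : ℕ,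
      Integrable (fun s => w s * (s : ℂ) ^ m) (volume.restrict (Set.Ioc (0 : ℝ) 1)) ∧
      ∫ s in Set.Ioc (0 : ℝ) 1, w s * (s : ℂ) ^ m = poch b m / poch c m := by
  have ne : ∀ {z : ℂ}, 0 < z.re → ∀ m : ℕ, z ≠ -m := fun hz m h => by
    have h1 := congrArg Complex.re h
    rw [Complex.neg_re, Complex.natCast_re] at h1
    have : (0 : ℝ) ≤ m := m.cast_nonneg
    linarith
  have hcpos : 0 < c.re := by rw [Complex.sub_re] at hc; linarith
  have hbm : ∀ m : ℕ, 0 < (b + m).re := fun m => by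
    rw [Complex.add_re, Complex.natCast_re]; positivity
  have hpow : ∀ m : ℕ, ∀ s ∈ Set.Ioc (0 : ℝ) 1,
      (s : ℂ) ^ (b - 1) * (1 - (s : ℂ)) ^ (c - b - 1) * (s : ℂ) ^ m
      = (s : ℂ) ^ (b + m - 1) * (1 - (s : ℂ)) ^ (c - b - 1) := fun m s hs => by
    rw [show b + m - 1 = b - 1 + m by ring,
      Complex.cpow_add _ _ (by exact_mod_cast hs.1.ne'), Complex.cpow_natCast]
    ring
  have hB : ∀ m : ℕ, Complex.betaIntegral (b + m) (c - b)
      = Complex.Gamma (b + m) * Complex.Gamma (c - b) / Complex.Gamma (c + m) := fun m => by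
    rw [Complex.betaIntegral_eq_Gamma_mul_div _ _ (hbm m) hc,
      show b + m + (c - b) = c + m by ring]
  have g1 := Complex.Gamma_ne_zero_of_re_pos hb
  have g2 := Complex.Gamma_ne_zero_of_re_pos hc
  have g3 := Complex.Gamma_ne_zero_of_re_pos hcpos
  refine ⟨fun s => Complex.Gamma c / (Complex.Gamma b * Complex.Gamma (c - b)) *
    ((s : ℂ) ^ (b - 1) * (1 - (s : ℂ)) ^ (c - b - 1)), fun m => ⟨?_, ?_⟩⟩
  · simp only [mul_assoc (Complex.Gamma c / _)]
    refine Integrable.const_mul ?_ _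
    have h := (Complex.betaIntegral_convergent (hbm m) hc)
    rw [intervalIntegrable_iff_integrableOn_Ioc_of_le zero_le_one] at h
    exact h.congr_fun (fun s hs => (hpow m s hs).symm) measurableSet_Ioc
  · simp only [mul_assoc (Complex.Gamma c / _)]
    rw [integral_const_mul, setIntegral_congr_fun measurableSet_Ioc (hpow m),
      ← intervalIntegral.integral_of_le zero_le_one]
    have := hB m
    rw [Complex.betaIntegral] at this
    rw [this, poch_eq_Gamma b m (ne hb), poch_eq_Gamma c m (ne hcpos)]
    have g4 := Complex.Gamma_ne_zero_of_re_pos (hbm m)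
    field_simp

theorem summable_poch_div_factorial (a : ℂ) {σ : ℝ} (h0 : 0 ≤ σ) (h1 : σ < 1) :
    Summable fun j : ℕ => ‖poch a j / j.factorial‖ * σ ^ j := by
  obtain ⟨η, hη, hη2⟩ := exists_one_lt_mul_lt h0 h1
  obtain ⟨C, hC, h⟩ := norm_poch_le a hη
  have hη0 : 0 < η := by linarith
  have hs : η * σ < 1 := lt_of_le_of_lt (le_mul_of_one_le_left (by positivity) hη.le) hη2
  refine ((summable_geometric_of_lt_one (by positivity) hs).mul_left C).of_nonneg_of_le
    (fun j => by positivity) fun j => ?_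
  rw [norm_div, Complex.norm_natCast, mul_pow, ← mul_assoc]
  gcongr
  rw [div_le_iff₀ (by positivity)]
  exact h j

theorem summable_binomial (a : ℂ) {X : ℂ} (hX : ‖X‖ < 1) :
    Summable fun j : ℕ => poch a j / j.factorial * X ^ j :=
  .of_norm ((summable_poch_div_factorial a (norm_nonneg X) hX).congr fun j => by
    rw [norm_mul, norm_pow])

theorem one_sub_mul_tsum_binomial (a : ℂ) {X : ℂ} (hX : ‖X‖ < 1) :
    (1 - X) * ∑' j : ℕ, poch (a + 1) j / j.factorial * X ^ j
      = ∑' j : ℕ, poch a j / j.factorial * X ^ j := by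
  have h := summable_binomial (a + 1) hX
  have h' := summable_binomial a hX
  rw [sub_mul, one_mul, ← tsum_mul_left, h.tsum_eq_zero_add, h'.tsum_eq_zero_add, add_sub_assoc,
    ← ((summable_nat_add_iff 1).mpr h).tsum_sub (h.mul_left X)]
  congr 1
  refine tsum_congr fun j => ?_
  have hj : (j.factorial : ℂ) ≠ 0 := by exact_mod_cast j.factorial_ne_zero
  have hj' : (j : ℂ) + 1 ≠ 0 := by exact_mod_cast j.succ_ne_zero
  rw [poch_succ, poch_succ' a, Nat.factorial_succ]
  push_cast
  field_simp
  ring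

/-- This is (1-X)^k (1-X)^{-a-k} = (1-X)^{-a}, kept at the level of power series so that no branch
of a complex power is needed. -/
theorem one_sub_pow_mul_tsum_binomial (a : ℂ) {X : ℂ} (hX : ‖X‖ < 1) (k : ℕ) :
    (1 - X) ^ k * ∑' j : ℕ, poch (a + k) j / j.factorial * X ^ j
      = ∑' j : ℕ, poch a j / j.factorial * X ^ j := by
  induction k with
  | zero => simp
  | succ k ih =>
    rw [← ih, pow_succ, mul_assoc, ← one_sub_mul_tsum_binomial (a + k) hX]
    push_cast
    rw [add_assoc]

theorem summable_kap_div_factorial (a : ℂ) (k : ℕ) {σ : ℝ} (h0 : 0 ≤ σ) (h1 : σ < 1) :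
    Summable fun M : ℕ => ‖kap a k M / M.factorial‖ * σ ^ M := by
  rw [← summable_nat_add_iff k]
  refine ((summable_poch_div_factorial (a + k) h0 h1).mul_left (σ ^ k)).congr fun j => ?_
  have hj : ((k + j).factorial : ℂ) ≠ 0 := by exact_mod_cast (k + j).factorial_ne_zero
  have e : kap a k (k + j) / (k + j).factorial = poch (a + k) j / j.factorial := by
    rw [kap_add_left]; field_simp
  rw [add_comm j k, e, pow_add]
  ring

theorem tsum_kap_div_factorial (a : ℂ) (k : ℕ) {X : ℂ} (hX : ‖X‖ < 1) :
    ∑' M : ℕ, kap a k M / M.factorial * X ^ M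
      = X ^ k * ∑' j : ℕ, poch (a + k) j / j.factorial * X ^ j := by
  have hs : Summable fun M : ℕ => kap a k M / M.factorial * X ^ M :=
    .of_norm ((summable_kap_div_factorial a k (norm_nonneg X) hX).congr fun j => by
      rw [norm_mul, norm_pow])
  rw [← hs.sum_add_tsum_nat_add k, sum_eq_zero, zero_add, ← tsum_mul_left]
  · refine tsum_congr fun j => ?_
    have hj : ((k + j).factorial : ℂ) ≠ 0 := by exact_mod_cast (k + j).factorial_ne_zero
    rw [add_comm j k, kap_add_left, pow_add]
    field_simp
  · intro M hM
    rw [kap_of_lt a (mem_range.mp hM)]; simp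

/-- ‖X‖² = ‖1-X‖² - (1 - 2 Re X), and ‖1-X‖² ≤ 4 gives 1 - 2κ ≥ (1-2κ)/4 · ‖1-X‖². The remaining
factor is 1 - (1-2κ)/4 = (3+2κ)/4. -/
theorem norm_le_mul_norm_one_sub {κ : ℝ} {X : ℂ} (hX : ‖X‖ < 1)
    (hre : X.re ≤ κ) (hκ : κ < 1 / 2) : ‖X‖ ≤ √((3 + 2 * κ) / 4) * ‖1 - X‖ := by
  have h2 : ‖1 - X‖ ≤ 2 := (norm_sub_le _ _).trans (by rw [norm_one]; linarith)
  have h3 : ‖X‖ ^ 2 = ‖1 - X‖ ^ 2 - (1 - 2 * X.re) := by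
    rw [Complex.sq_norm, Complex.sq_norm, Complex.normSq_apply, Complex.normSq_apply]
    simp; ring
  rw [← Real.sqrt_sq (norm_nonneg (1 - X)), ← Real.sqrt_mul' _ (sq_nonneg _)]
  refine Real.le_sqrt_of_sq_le ?_
  rw [h3]
  nlinarith [mul_le_mul h2 h2 (norm_nonneg _) zero_le_two]

/-- The sum is (X/(1-X))^k times the binomial series of (1-X)^{-a}, which is bounded uniformly on
‖X‖ ≤ σ. -/
theorem norm_tsum_kap_le (a : ℂ) {σ κ : ℝ} (hσ : σ < 1) (hκ : κ < 1 / 2) (k : ℕ)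
    {X : ℂ} (hX : ‖X‖ ≤ σ) (hre : X.re ≤ κ) :
    ‖∑' M : ℕ, kap a k M / M.factorial * X ^ M‖
      ≤ (∑' j : ℕ, ‖poch a j / j.factorial‖ * σ ^ j) * √((3 + 2 * κ) / 4) ^ k := by
  have hX1 : ‖X‖ < 1 := hX.trans_lt hσ
  have h0 : 0 ≤ σ := (norm_nonneg X).trans hX
  have hne : 0 < ‖1 - X‖ := norm_pos_iff.mpr fun h => by
    rw [← sub_eq_zero.mp h, norm_one] at hX1; exact lt_irrefl _ hX1
  have hθ := norm_le_mul_norm_one_sub hX1 hre hκ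
  have hS : ‖∑' j : ℕ, poch a j / j.factorial * X ^ j‖
      ≤ ∑' j : ℕ, ‖poch a j / j.factorial‖ * σ ^ j :=
    tsum_of_norm_bounded (summable_poch_div_factorial a h0 hσ).hasSum fun j => by
      rw [norm_mul, norm_pow]; gcongr
  have h := congrArg norm (one_sub_pow_mul_tsum_binomial a hX1 k)
  rw [norm_mul, norm_pow] at h
  rw [tsum_kap_div_factorial a k hX1, norm_mul, norm_pow]
  calc ‖X‖ ^ k * ‖∑' j : ℕ, poch (a + k) j / j.factorial * X ^ j‖
      ≤ (√((3 + 2 * κ) / 4) * ‖1 - X‖) ^ k * ‖∑' j : ℕ, poch (a + k) j / j.factorial * X ^ j‖ := by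
        gcongr
    _ = (‖1 - X‖ ^ k * ‖∑' j : ℕ, poch (a + k) j / j.factorial * X ^ j‖)
          * √((3 + 2 * κ) / 4) ^ k := by ring
    _ ≤ _ := by rw [h]; gcongr

-- Write each (b_i)_m/(c_i)_m as a moment of a Beta weight and sum under the integral over the cube:
-- the integrand becomes the weight times the series of `norm_tsum_kap_le` at X = ∑ s_i x_i. There
-- ‖X‖ ≤ ∑ ‖x i‖ and Re X ≤ ∑ max(Re x_i, 0), so the bound is uniform in s.
open MeasureTheory in
theorem hasDecay_of_re_pos {n : ℕ} (x : Fin n → ℂ) (hx : ∑ i, ‖x i‖ < 1)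
    (hx' : ∑ i, max (x i).re 0 < 1 / 2) (b c : Fin n → ℂ) (hb : ∀ i, 0 < (b i).re)
    (hcb : ∀ i, 0 < (c i - b i).re) :
    HasDecay (√((3 + 2 * ∑ i, max (x i).re 0) / 4))
      fun m => ∏ i, phi (b i) (c i) (x i) (m i) := by
  have hc : ∀ i, ∀ m : ℕ, c i ≠ -m := fun i m h => by
    have h1 := congrArg Complex.re h
    have h2 := hb i
    have h3 := hcb i
    rw [Complex.neg_re, Complex.natCast_re] at h1
    rw [Complex.sub_re] at h3
    have : (0 : ℝ) ≤ m := m.cast_nonneg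
    linarith
  refine ⟨fun a k => (summable_norm_kap_mul_phi a k b hc hx).of_norm, fun a => ?_⟩
  choose w hw using fun i => exists_beta_moments (hb i) (hcb i)
  set μ : Measure ℝ := volume.restrict (Set.Ioc (0 : ℝ) 1) with hμ
  set ν : Measure (Fin n → ℝ) := Measure.pi fun _ => μ with hν
  have hcube : ∀ᵐ s ∂ν, ∀ i, s i ∈ Set.Ioc (0 : ℝ) 1 := by
    have : ν = (Measure.pi fun _ => volume).restrict
        (Set.univ.pi fun _ : Fin n => Set.Ioc (0 : ℝ) 1) := by
      rw [Measure.restrict_pi_pi]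
    rw [this]
    filter_upwards [ae_restrict_mem (MeasurableSet.univ_pi fun _ => measurableSet_Ioc)] with s hs i
    exact hs i (Set.mem_univ i)
  have hw0 : Integrable (fun s : Fin n → ℝ => ∏ i, w i (s i)) ν :=
    Integrable.fintype_prod fun i => by simpa using (hw i 0).1
  set S := ∑' j : ℕ, ‖poch a j / j.factorial‖ * (∑ i, ‖x i‖) ^ j
  refine ⟨(∫ s, ‖∏ i, w i (s i)‖ ∂ν) * S, 0, fun k => ?_⟩
  let K : (Fin n → ℕ) → ℂ := fun m => kap a k (∑ i, m i) * ∏ i, (x i ^ m i / (m i).factorial)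
  let F : (Fin n → ℕ) → (Fin n → ℝ) → ℂ := fun m s => K m * ∏ i, (w i (s i) * (s i : ℂ) ^ m i)
  have hK : Summable fun m => ‖K m‖ := by
    refine (tsum_multinomial (w := fun M => kap a k M / M.factorial) (r := x)
      (summable_kap_div_factorial a k (sum_nonneg fun i _ => norm_nonneg (x i)) hx)).1.congr
      fun m => ?_
    have : ((∑ i, m i).factorial : ℂ) ≠ 0 := by exact_mod_cast (∑ i, m i).factorial_ne_zero
    rw [← mul_assoc, div_mul_cancel₀ _ this]
  have hFint : ∀ m, Integrable (F m) ν := fun m =>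
    (Integrable.fintype_prod fun i => (hw i (m i)).1).const_mul _
  have hFval : ∀ m, ∫ s, F m s ∂ν = kap a k (∑ i, m i) * ∏ i, phi (b i) (c i) (x i) (m i) := by
    intro m
    rw [integral_const_mul, integral_fintype_prod_eq_prod
      (f := fun i t => w i t * (t : ℂ) ^ m i), mul_assoc, ← prod_mul_distrib]
    congr 1
    refine prod_congr rfl fun i _ => ?_
    rw [(hw i (m i)).2, phi]
    ring
  have hFnorm : ∀ m, ∀ᵐ s ∂ν, ‖F m s‖ ≤ ‖K m‖ * ‖∏ i, w i (s i)‖ := fun m => by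
    filter_upwards [hcube] with s hs
    simp only [F]
    rw [prod_mul_distrib, norm_mul, norm_mul (∏ i, w i (s i))]
    refine mul_le_mul_of_nonneg_left (mul_le_of_le_one_right (norm_nonneg _) ?_) (norm_nonneg _)
    rw [norm_prod]
    refine prod_le_one (fun i _ => norm_nonneg _) fun i _ => ?_
    rw [norm_pow, Complex.norm_real, Real.norm_of_nonneg (hs i).1.le]
    exact pow_le_one₀ (hs i).1.le (hs i).2
  have hFsum : Summable fun m => ∫ s, ‖F m s‖ ∂ν := by
    refine (hK.mul_right (∫ s, ‖∏ i, w i (s i)‖ ∂ν)).of_nonneg_of_le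
      (fun m => integral_nonneg fun s => norm_nonneg _) fun m => ?_
    rw [← integral_const_mul]
    exact integral_mono_ae (hFint m).norm (hw0.norm.const_mul _) (hFnorm m)
  have hmain := integral_tsum_of_summable_integral_norm hFint hFsum
  simp only [hFval] at hmain
  rw [hmain, pow_zero, mul_one, mul_assoc, ← integral_mul_const]
  refine norm_integral_le_of_norm_le (hw0.norm.mul_const _) ?_
  filter_upwards [hcube] with s hs
  have hsx : ∀ i, ‖(s i : ℂ) * x i‖ ≤ ‖x i‖ := fun i => by
    rw [norm_mul, Complex.norm_real, Real.norm_of_nonneg (hs i).1.le]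
    exact mul_le_of_le_one_left (norm_nonneg _) (hs i).2
  have hsum : ∑ i, ‖(s i : ℂ) * x i‖ ≤ ∑ i, ‖x i‖ := sum_le_sum fun i _ => hsx i
  have hX : ‖∑ i, (s i : ℂ) * x i‖ ≤ ∑ i, ‖x i‖ := (norm_sum_le _ _).trans hsum
  have hre : (∑ i, (s i : ℂ) * x i).re ≤ ∑ i, max (x i).re 0 := by
    rw [Complex.re_sum]
    refine sum_le_sum fun i _ => ?_
    rw [Complex.re_ofReal_mul]
    rcases le_total (x i).re 0 with h | h
    · exact (mul_nonpos_of_nonneg_of_nonpos (hs i).1.le h).trans (le_max_right _ _)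
    · exact (mul_le_of_le_one_left h (hs i).2).trans (le_max_left _ _)
  have hF : ∑' m, F m s = (∏ i, w i (s i)) *
      ∑' M : ℕ, kap a k M / M.factorial * (∑ i, (s i : ℂ) * x i) ^ M := by
    rw [← (tsum_multinomial (w := fun M => kap a k M / M.factorial)
      (r := fun i => (s i : ℂ) * x i) (summable_kap_div_factorial a k
        (sum_nonneg fun i _ => norm_nonneg ((s i : ℂ) * x i)) (hsum.trans_lt hx))).2, ← tsum_mul_left]
    refine tsum_congr fun m => ?_
    have hf : ((∑ i, m i).factorial : ℂ) ≠ 0 := by exact_mod_cast (∑ i, m i).factorial_ne_zero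
    simp only [F, K]
    rw [← mul_assoc (kap a k (∑ i, m i) / _), div_mul_cancel₀ _ hf, prod_mul_distrib, mul_assoc,
      mul_left_comm (∏ i, _) (∏ i, w i (s i)), ← prod_mul_distrib, mul_left_comm]
    congr 2
    refine prod_congr rfl fun i _ => ?_
    ring
  rw [hF, norm_mul]
  gcongr
  exact norm_tsum_kap_le a hx hx' k hX hre

/-- Geometric decay of the sums `∑ M! / (M - k)! (a + k)_{M - k} ∏ (b_i)_{m_i} / (c_i)_{m_i} ⋯`. -/
theorem exists_norm_tsum_kap_le {n : ℕ} (a : ℂ) (b : Fin n → ℂ) {c x : Fin n → ℂ}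
    (hc : ∀ i, ∀ m : ℕ, c i ≠ -m) (hx : ∑ i, ‖x i‖ < 1) (hx' : ∑ i, max (x i).re 0 < 1 / 2) :
    ∃ C θ : ℝ, 0 ≤ C ∧ 0 < θ ∧ θ < 1 ∧ ∀ k : ℕ,
      ‖∑' m : Fin n → ℕ, kap a k (∑ i, m i) * ∏ i, phi (b i) (c i) (x i) (m i)‖ ≤ C * θ ^ k := by
  have h0 : 0 ≤ ∑ i, max (x i).re 0 := sum_nonneg fun i _ => le_max_right _ _
  set θ := √((3 + 2 * ∑ i, max (x i).re 0) / 4) with hθ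
  have hpos : 0 < θ := Real.sqrt_pos.mpr (by linarith)
  have hlt : θ < 1 := by rw [hθ, Real.sqrt_lt' one_pos]; linarith
  obtain ⟨C, D, h⟩ :=
    (hasDecay_prod_phi_of_re_pos hpos x (hasDecay_of_re_pos x hx hx') b hc).2 a
  -- The slightly larger rate τ absorbs the polynomial factor, since (k+1)^D (θ/τ)^{k+1} is bounded.
  obtain ⟨τ, h1, h2⟩ := exists_between hlt
  have hτ : 0 < τ := hpos.trans h1
  have hlim := tendsto_pow_const_mul_const_pow_of_abs_lt_one D
    (r := θ / τ) (by rw [abs_of_pos (by positivity), div_lt_one hτ]; exact h1)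
  obtain ⟨B, hB⟩ := ((Filter.tendsto_add_atTop_iff_nat 1).mpr hlim).bddAbove_range
  have hB0 : 0 ≤ B := le_trans (by positivity) (hB ⟨0, rfl⟩)
  refine ⟨|C| * (B * τ / θ), τ, by positivity, hτ, h2, fun k => ?_⟩
  have hk : ((k + 1 : ℕ) : ℝ) ^ D * (θ / τ) ^ (k + 1) ≤ B := hB ⟨k, rfl⟩
  push_cast at hk
  refine (h k).trans ?_
  calc C * ((k : ℝ) + 1) ^ D * θ ^ k ≤ |C| * ((k : ℝ) + 1) ^ D * θ ^ k := by
        have := le_abs_self C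
        gcongr
    _ = |C| * ((((k : ℝ) + 1) ^ D * (θ / τ) ^ (k + 1)) * τ / θ * τ ^ k) := by
        rw [div_pow]; field_simp; ring
    _ ≤ |C| * (B * τ / θ * τ ^ k) := by gcongr
    _ = _ := by ring

/-! ### Expansion of F_A(a - q) in the sums `kapSum` -/

/-- `∑_m M! / (M - k)! (a + k)_{M - k} ∏ (b_i)_{m_i} x_i^{m_i} / ((c_i)_{m_i} m_i!)`, `M = |m|`. -/
noncomputable def kapSum {n : ℕ} (a : ℂ) (b c x : Fin n → ℂ) (k : ℕ) : ℂ :=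
  ∑' m : Fin n → ℕ, kap a k (∑ i, m i) * ∏ i, phi (b i) (c i) (x i) (m i)

theorem lauricellaATerm_eq {n : ℕ} (a : ℂ) (b c x : Fin n → ℂ) (m : Fin n → ℕ) :
    lauricellaATerm a b c x m = kap a 0 (∑ i, m i) * ∏ i, phi (b i) (c i) (x i) (m i) := by
  rw [kap_zero]; rfl

theorem kapSum_zero {n : ℕ} (a : ℂ) (b c x : Fin n → ℂ) :
    kapSum a b c x 0 = lauricellaA a b c x :=
  tsum_congr fun m => (lauricellaATerm_eq a b c x m).symm

theorem summable_lauricellaATerm {n : ℕ} (a : ℂ) (b : Fin n → ℂ) {c x : Fin n → ℂ}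
    (hc : ∀ i, ∀ m : ℕ, c i ≠ -m) (hx : ∑ i, ‖x i‖ < 1) : Summable (lauricellaATerm a b c x) :=
  (summable_norm_kap_mul_phi a 0 b hc hx).of_norm.congr fun m => (lauricellaATerm_eq a b c x m).symm

theorem kapSum_add_one_param {n : ℕ} (a : ℂ) (b : Fin n → ℂ) {c x : Fin n → ℂ}
    (hc : ∀ i, ∀ m : ℕ, c i ≠ -m) (hx : ∑ i, ‖x i‖ < 1) (k : ℕ) :
    kapSum (a + 1) b c x k = kapSum a b c x k + kapSum a b c x (k + 1) := by
  rw [kapSum, kapSum, kapSum, ← (summable_norm_kap_mul_phi a k b hc hx).of_norm.tsum_add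
    (summable_norm_kap_mul_phi a (k + 1) b hc hx).of_norm]
  exact tsum_congr fun m => by rw [kap_add_one_param, add_mul]

/-- The coefficient C(q+j-1, j) is at most C(q+j, j), and C(q+j, j) z^j (1-z)^q is one term of the
expansion of (z + (1-z))^{q+j} = 1. -/
theorem multichoose_mul_le {z : ℝ} (h0 : 0 ≤ z) (h1 : z ≤ 1) (q j : ℕ) :
    (q.multichoose j : ℝ) * (z ^ j * (1 - z) ^ q) ≤ 1 := by
  have h2 : 0 ≤ 1 - z := by linarith
  have hle : (q.multichoose j : ℝ) ≤ ((q + j).choose j : ℝ) := by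
    rw [Nat.multichoose_eq]
    exact_mod_cast Nat.choose_mono j (Nat.sub_le _ _)
  have hsum := add_pow z (1 - z) (q + j)
  rw [add_sub_cancel, one_pow] at hsum
  have hs := single_le_sum
    (f := fun m => z ^ m * (1 - z) ^ (q + j - m) * ((q + j).choose m : ℝ))
    (fun m _ => by positivity) (mem_range.mpr (by omega : j < q + j + 1))
  rw [← hsum, Nat.add_sub_cancel] at hs
  calc _ ≤ ((q + j).choose j : ℝ) * (z ^ j * (1 - z) ^ q) := by gcongr
    _ = z ^ j * (1 - z) ^ q * ((q + j).choose j : ℝ) := mul_comm _ _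
    _ ≤ 1 := hs

/-- Separates q from j: the rate worsens from θ to θ/z, at a cost exponential in q. Taking θ < z < 1
keeps the rate below 1. -/
theorem multichoose_mul_pow_le {θ z : ℝ} (hθ : 0 ≤ θ) (h0 : 0 < z) (h1 : z < 1) (q j : ℕ) :
    (q.multichoose j : ℝ) * θ ^ j ≤ (1 - z)⁻¹ ^ q * (θ / z) ^ j := by
  have h := multichoose_mul_le h0.le h1.le q j
  have h2 : 0 < 1 - z := by linarith
  calc (q.multichoose j : ℝ) * θ ^ j
      = (q.multichoose j : ℝ) * (z ^ j * (1 - z) ^ q) * ((1 - z)⁻¹ ^ q * (θ / z) ^ j) := by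
        rw [div_pow, inv_pow]; field_simp
    _ ≤ 1 * ((1 - z)⁻¹ ^ q * (θ / z) ^ j) := by gcongr
    _ = _ := one_mul _

theorem summable_multichoose_mul_pow {θ : ℝ} (hθ : 0 ≤ θ) (h1 : θ < 1) (q : ℕ) :
    Summable fun j : ℕ => (q.multichoose j : ℝ) * θ ^ j := by
  obtain ⟨z, hz, hz1⟩ := exists_between h1
  have h0 : 0 < z := hθ.trans_lt hz
  exact ((summable_geometric_of_lt_one (by positivity) ((div_lt_one h0).mpr hz)).mul_left
    ((1 - z)⁻¹ ^ q)).of_nonneg_of_le (fun j => by positivity)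
      fun j => multichoose_mul_pow_le hθ h0 hz1 q j

/-- Inversion of `h_q(k) = h_{q+1}(k) + h_{q+1}(k + 1)` for sequences of geometric decay. -/
theorem hasSum_multichoose {h : ℕ → ℕ → ℂ} (hrec : ∀ q k, h q k = h (q + 1) k + h (q + 1) (k + 1))
    (hdecay : ∀ q, ∃ C θ : ℝ, 0 ≤ C ∧ 0 < θ ∧ θ < 1 ∧ ∀ k, ‖h q k‖ ≤ C * θ ^ k) (q k : ℕ) :
    HasSum (fun j : ℕ => (-1 : ℂ) ^ j * q.multichoose j * h 0 (k + j)) (h q k) := by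
  obtain ⟨C, θ, hC, hθ, hθ1, hb⟩ := hdecay 0
  have hbound : ∀ q k j : ℕ, ‖(-1 : ℂ) ^ j * q.multichoose j * h 0 (k + j)‖
      ≤ C * θ ^ k * ((q.multichoose j : ℝ) * θ ^ j) := fun q k j => by
    rw [norm_mul, norm_mul, norm_pow, norm_neg, norm_one, one_pow, one_mul, Complex.norm_natCast]
    calc (q.multichoose j : ℝ) * ‖h 0 (k + j)‖ ≤ q.multichoose j * (C * θ ^ (k + j)) := by
          gcongr; exact hb _
      _ = _ := by ring
  have hsumm : ∀ q k : ℕ, Summable fun j : ℕ => (-1 : ℂ) ^ j * q.multichoose j * h 0 (k + j) :=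
    fun q k => .of_norm_bounded ((summable_multichoose_mul_pow hθ.le hθ1 q).mul_left _) (hbound q k)
  refine (hsumm q k).hasSum_iff.mpr ?_
  induction q generalizing k with
  | zero =>
    rw [tsum_eq_single 0]
    · simp
    · intro j hj
      obtain ⟨j, rfl⟩ := Nat.exists_eq_succ_of_ne_zero hj
      simp
  | succ q ih =>
    set S : ℕ → ℂ := fun k => ∑' j : ℕ, (-1 : ℂ) ^ j * (q + 1).multichoose j * h 0 (k + j) with hS
    have hSrec : ∀ k, S k + S (k + 1) = h q k := fun k => by
      rw [← ih k, hS]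
      simp only
      rw [(hsumm (q + 1) k).tsum_eq_zero_add, (hsumm q k).tsum_eq_zero_add, add_assoc,
        ← ((summable_nat_add_iff 1).mpr (hsumm (q + 1) k)).tsum_add (hsumm (q + 1) (k + 1))]
      congr 1
      · simp
      refine tsum_congr fun j => ?_
      rw [Nat.multichoose_succ_succ, show k + 1 + j = k + (j + 1) by omega]
      push_cast
      ring
    -- The sums S and the sequence h (q+1) solve the same recurrence, so their difference only
    -- changes sign from k to k + 1. Its norm is constant in k yet tends to 0, hence vanishes.
    have hd : ∀ k j, ‖S k - h (q + 1) k‖ = ‖S (k + j) - h (q + 1) (k + j)‖ := fun k j => by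
      induction j with
      | zero => rfl
      | succ j ihj =>
        rw [ihj, ← norm_neg]
        congr 1
        have h1 := hSrec (k + j)
        have h2 := hrec q (k + j)
        rw [← add_assoc]
        linear_combination -h2 - h1
    obtain ⟨C', θ', hC', hθ', hθ1', hb'⟩ := hdecay (q + 1)
    have hSb : ∀ k, ‖S k‖ ≤ C * θ ^ k * ∑' j, (((q + 1).multichoose j : ℝ) * θ ^ j) := fun k =>
      tsum_of_norm_bounded ((summable_multichoose_mul_pow hθ.le hθ1 (q + 1)).hasSum.mul_left _)
        (hbound (q + 1) k)
    have hlim : Filter.Tendsto (fun j => C * θ ^ (k + j) * (∑' j, (((q + 1).multichoose j : ℝ) * θ ^ j))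
        + C' * θ' ^ (k + j)) Filter.atTop (nhds (C * 0 * (∑' j, (((q + 1).multichoose j : ℝ) * θ ^ j))
        + C' * 0)) := by
      have t : ∀ {θ : ℝ}, 0 < θ → θ < 1 →
          Filter.Tendsto (fun j => θ ^ (k + j)) Filter.atTop (nhds 0) := fun h0 h1 =>
        (tendsto_pow_atTop_nhds_zero_of_lt_one h0.le h1).comp
          (Filter.tendsto_atTop_mono (fun j => Nat.le_add_left j k) Filter.tendsto_id)
      exact (((t hθ hθ1).const_mul C).mul_const _).add ((t hθ' hθ1').const_mul C')
    have hle : ‖S k - h (q + 1) k‖ ≤ C * 0 * (∑' j, (((q + 1).multichoose j : ℝ) * θ ^ j))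
        + C' * 0 := ge_of_tendsto' hlim fun j => by
      rw [hd k j]
      exact (norm_sub_le _ _).trans (add_le_add (hSb _) (hb' _))
    rw [mul_zero, zero_mul, mul_zero, add_zero] at hle
    exact sub_eq_zero.mp (norm_le_zero_iff.mp hle)

/-- The averaged form of (1-X)^q = (1 + X/(1-X))^{-q}: inversion applied to h q k = `kapSum (a - q)
b c x k`, read off at k = 0. -/
theorem hasSum_lauricellaA_sub {n : ℕ} (a : ℂ) (b : Fin n → ℂ) {c x : Fin n → ℂ}
    (hc : ∀ i, ∀ m : ℕ, c i ≠ -m) (hx : ∑ i, ‖x i‖ < 1) (hx' : ∑ i, max (x i).re 0 < 1 / 2)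
    (q : ℕ) :
    HasSum (fun j : ℕ => (-1 : ℂ) ^ j * q.multichoose j * kapSum a b c x j)
      (lauricellaA (a - q) b c x) := by
  have h := hasSum_multichoose (h := fun q k => kapSum (a - q) b c x k) (fun q k => by
    rw [← kapSum_add_one_param _ b hc hx]; push_cast; congr 1; ring)
    (fun q => exists_norm_tsum_kap_le (a - q) b hc hx hx') q 0
  simpa [kapSum_zero] using h

/-! ### Separation of m and q in H_A, and exchange of summations -/

theorem poch_reflect (z : ℂ) (k : ℕ) : poch (1 - z - k) k = (-1) ^ k * poch z k := by
  induction k with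
  | zero => simp [poch]
  | succ k ih =>
    rw [poch_succ', poch_succ, show 1 - z - ((k + 1 : ℕ) : ℂ) + 1 = 1 - z - k by push_cast; ring, ih]
    push_cast
    ring

theorem one_sub_ne_neg_nat {a : ℂ} (ha : ∀ m : ℕ, a ≠ m + 1) (m : ℕ) : 1 - a ≠ -m := fun h =>
  ha m (by linear_combination -h)

/-- This is (a)_{M-N} = (a-N)_M (a)_{-N} with (a)_{-N} = (-1)^N/(1-a)_N. If N ≤ M, the first N
factors of (a-N)_M cancel (1-a)_N by reflection; otherwise (a-N)_M cancels the last M factors of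
(1-a)_N. -/
theorem pochZ_sub {a : ℂ} (ha : ∀ m : ℕ, a ≠ m + 1) (M N : ℕ) :
    pochZ a ((M : ℤ) - N) = poch (a - N) M * ((-1) ^ N * (poch (1 - a) N)⁻¹) := by
  have ha' := one_sub_ne_neg_nat ha
  have hsq : ∀ k : ℕ, ((-1 : ℂ) ^ k) * (-1) ^ k = 1 := fun k => by rw [← mul_pow]; simp
  rcases le_or_gt N M with h | h
  · obtain ⟨j, rfl⟩ := Nat.exists_eq_add_of_le h
    have hr := poch_reflect (1 - a) N
    rw [sub_sub_cancel] at hr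
    rw [pochZ, if_pos (by push_cast; omega), poch_add, sub_add_cancel, hr]
    have : (((N + j : ℕ) : ℤ) - N).toNat = j := by push_cast; omega
    rw [this]
    have hne := poch_ne_zero ha' N
    field_simp
    linear_combination (-poch a j) * hsq N
  · obtain ⟨j, rfl⟩ := Nat.exists_eq_add_of_lt h
    have hr := poch_reflect (1 - a + (j + 1 : ℕ)) M
    rw [show 1 - (1 - a + ((j + 1 : ℕ) : ℂ)) - M = a - ((M + j + 1 : ℕ) : ℂ) by push_cast; ring] at hr
    rw [pochZ, if_neg (by push_cast; omega), hr, show M + j + 1 = (j + 1) + M by omega, poch_add]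
    have : (-((M : ℤ) - ((j + 1 + M : ℕ) : ℤ))).toNat = j + 1 := by push_cast; omega
    rw [this]
    have h1 : ∏ r ∈ range (j + 1), (a - (r + 1)) = (-1) ^ (j + 1) * poch (1 - a) (j + 1) := by
      rw [poch, ← card_range (j + 1), ← prod_const, card_range, ← prod_mul_distrib]
      exact prod_congr rfl fun r _ => by ring
    have hne := poch_ne_zero ha' (j + 1)
    have hne2 := poch_ne_zero (shift_ne_neg_nat ha' (j + 1)) M
    rw [h1, pow_add]
    field_simp
    have h2 := hsq (j + 1)
    have h3 := hsq M
    linear_combination h2 + ((-1) ^ (j + 1)) ^ 2 * h3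

/-- Uniformity in N comes from (a-N-1)_{M+1} = (a-N)_{M+1} - (M+1) (a-N)_M: each unit step in N at
most doubles the bound. -/
theorem norm_poch_sub_natCast_le (a : ℂ) {η : ℝ} (hη : 1 < η) :
    ∃ C, 0 ≤ C ∧ ∀ N M : ℕ, ‖poch (a - N) M‖ ≤ C * 2 ^ N * η ^ M * M.factorial := by
  obtain ⟨C, hC, h⟩ := norm_poch_le a hη
  refine ⟨C, hC, fun N => ?_⟩
  induction N with
  | zero => simpa using h
  | succ N ih =>
    intro M
    have hη0 : 0 < η := by linarith
    rcases M with _ | M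
    · refine (ih 0).trans ?_
      gcongr <;> simp
    · have e : poch (a - (N + 1 : ℕ)) (M + 1) = poch (a - N) (M + 1) - (M + 1) * poch (a - N) M := by
        rw [poch_succ', poch_succ, show a - ((N + 1 : ℕ) : ℂ) + 1 = a - N by push_cast; ring]
        push_cast; ring
      have hn : ‖((M : ℂ) + 1)‖ = (M : ℝ) + 1 := by exact_mod_cast Complex.norm_natCast (M + 1)
      have h1 := ih (M + 1)
      have h2 := ih M
      have h3 : η ^ M ≤ η ^ (M + 1) := pow_le_pow_right₀ hη.le (Nat.le_succ M)
      rw [e]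
      refine (norm_sub_le _ _).trans ?_
      rw [norm_mul, hn]
      calc _ ≤ C * 2 ^ N * η ^ (M + 1) * (M + 1).factorial
            + (M + 1) * (C * 2 ^ N * η ^ (M + 1) * M.factorial) := by
            gcongr
            refine h2.trans ?_
            gcongr
        _ = _ := by rw [Nat.factorial_succ]; push_cast; ring

theorem confluentHATerm_eq {n p : ℕ} {a : ℂ} (ha : ∀ m : ℕ, a ≠ m + 1) (b c x : Fin n → ℂ)
    (y : Fin p → ℂ) (m : Fin n → ℕ) (q : Fin p → ℕ) :
    confluentHATerm a b c x y (m, q)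
      = lauricellaATerm (a - (∑ j, q j : ℕ)) b c x m * zeroFTerm (1 - a) (-y) q := by
  have h := pochZ_sub ha (∑ i, m i) (∑ j, q j)
  push_cast at h
  have e : ∏ j, ((-y) j ^ q j / ((q j).factorial : ℂ))
      = (-1) ^ (∑ j, q j) * ∏ j, (y j ^ q j / ((q j).factorial : ℂ)) := by
    rw [← prod_pow_eq_pow_sum, ← prod_mul_distrib]
    refine prod_congr rfl fun j _ => ?_
    rw [Pi.neg_apply, neg_pow]; ring
  rw [confluentHATerm, lauricellaATerm, zeroFTerm, e, h]
  push_cast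
  ring

theorem summable_pow_mul_zeroFTerm {p : ℕ} {d : ℂ} (hd : ∀ m : ℕ, d ≠ -m) (y : Fin p → ℂ)
    {Z : ℝ} (hZ : 0 ≤ Z) : Summable fun q : Fin p → ℕ => Z ^ (∑ j, q j) * ‖zeroFTerm d y q‖ := by
  obtain ⟨C, hC, h⟩ := norm_inv_poch_le hd one_lt_two
  -- One 1/Q! comes from the bound for 1/(d)_Q; the other cancels the Q! built into
  -- `summable_multinomial`.
  have key := summable_multinomial (w := fun Q => C * (2 * Z) ^ Q / Q.factorial / Q.factorial)
    (r := fun j => ‖y j‖) (fun Q => by positivity) (fun j => norm_nonneg _) (by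
      refine ((Real.summable_pow_div_factorial (2 * Z * ∑ j, ‖y j‖)).mul_left C).of_nonneg_of_le
        (fun Q => ?_) fun Q => ?_
      · have : 0 ≤ ∑ j, ‖y j‖ := sum_nonneg fun j _ => norm_nonneg _
        positivity
      · have h0 : 0 ≤ ∑ j, ‖y j‖ := sum_nonneg fun j _ => norm_nonneg _
        have h1 : (1 : ℝ) ≤ Q.factorial := by exact_mod_cast Q.factorial_pos
        calc C * (2 * Z) ^ Q / Q.factorial / Q.factorial * (∑ j, ‖y j‖) ^ Q
            ≤ C * (2 * Z) ^ Q / Q.factorial * (∑ j, ‖y j‖) ^ Q := by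
              gcongr
              exact div_le_self (by positivity) h1
          _ = C * ((2 * Z * ∑ j, ‖y j‖) ^ Q / Q.factorial) := by
              rw [mul_pow (2 * Z)]; ring)
  refine key.of_nonneg_of_le (fun q => by positivity) fun q => ?_
  rw [zeroFTerm, norm_mul, norm_prod]
  simp only [norm_div, norm_pow, Complex.norm_natCast]
  have hf : ((∑ j, q j).factorial : ℝ) ≠ 0 := by exact_mod_cast (∑ j, q j).factorial_ne_zero
  have hP : 0 ≤ ∏ j, (‖y j‖ ^ q j / ((q j).factorial : ℝ)) :=
    prod_nonneg fun j _ => by positivity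
  calc Z ^ (∑ j, q j) * (‖(poch d (∑ j, q j))⁻¹‖ * ∏ j, (‖y j‖ ^ q j / ((q j).factorial : ℝ)))
      ≤ Z ^ (∑ j, q j) * ((C * 2 ^ (∑ j, q j) / (∑ j, q j).factorial)
          * ∏ j, (‖y j‖ ^ q j / ((q j).factorial : ℝ))) := by
        gcongr
        exact h _
    _ = _ := by rw [mul_pow]; field_simp

theorem summable_norm_zeroFTerm {p : ℕ} {d : ℂ} (hd : ∀ m : ℕ, d ≠ -m) (y : Fin p → ℂ) :
    Summable fun q : Fin p → ℕ => ‖zeroFTerm d y q‖ := by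
  simpa using summable_pow_mul_zeroFTerm hd y zero_le_one

theorem summable_confluentHATerm {n p : ℕ} {a : ℂ} (ha : ∀ m : ℕ, a ≠ m + 1) (b : Fin n → ℂ)
    {c x : Fin n → ℂ} (hc : ∀ i, ∀ m : ℕ, c i ≠ -m) (hx : ∑ i, ‖x i‖ < 1) (y : Fin p → ℂ) :
    Summable (confluentHATerm a b c x y) := by
  obtain ⟨η, hη, hs⟩ := exists_summable_factorial_mul_phi b hc hx
  obtain ⟨C, hC, h⟩ := norm_poch_sub_natCast_le a hη
  have hη0 : 0 < η := by linarith
  refine .of_norm_bounded ((hs.mul_of_nonneg ((summable_pow_mul_zeroFTerm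
    (one_sub_ne_neg_nat ha) (-y) zero_le_two).mul_left C) (fun m => by positivity)
      fun q => by positivity)) ?_
  rintro ⟨m, q⟩
  rw [confluentHATerm_eq ha, lauricellaATerm_eq, kap_zero, norm_mul, norm_mul]
  calc _ ≤ C * 2 ^ (∑ j, q j) * η ^ (∑ i, m i) * (∑ i, m i).factorial
        * ‖∏ i, phi (b i) (c i) (x i) (m i)‖ * ‖zeroFTerm (1 - a) (-y) q‖ := by
        gcongr
        exact h _ _
    _ = _ := by ring

theorem summable_multichoose_mul_zeroFTerm {p : ℕ} {d : ℂ} (hd : ∀ m : ℕ, d ≠ -m) (y : Fin p → ℂ)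
    (k : ℕ) : Summable fun q : Fin p → ℕ => ((∑ j, q j).multichoose k : ℂ) * zeroFTerm d y q := by
  refine .of_norm_bounded ((summable_pow_mul_zeroFTerm hd y zero_le_two).mul_left (2 ^ k))
    fun q => ?_
  have h := multichoose_mul_pow_le zero_le_one (z := 1 / 2) (by norm_num) (by norm_num)
    (∑ j, q j) k
  norm_num at h
  rw [norm_mul, Complex.norm_natCast, ← mul_assoc, mul_comm (2 ^ k)]
  gcongr

theorem tsum_eq_tsum_swap {α β : Type*} {f : α × β → ℂ} (hf : Summable f) :
    ∑' z, f z = ∑' b, ∑' a, f (a, b) := by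
  rw [← (Equiv.prodComm β α).tsum_eq f]
  exact Summable.tsum_prod ((Equiv.prodComm β α).summable_iff.mpr hf)

/-- With θ the decay rate of `kapSum` and θ < z < 1, the terms are dominated by (θ/z)^k times
(1-z)^{-|q|} times a term of ₀F_p, a product of two convergent series. -/
theorem summable_kapSum_mul_multichoose {n p : ℕ} (a : ℂ) (b : Fin n → ℂ)
    {c x : Fin n → ℂ} (hc : ∀ i, ∀ m : ℕ, c i ≠ -m) (hx : ∑ i, ‖x i‖ < 1)
    (hx' : ∑ i, max (x i).re 0 < 1 / 2) {d : ℂ} (hd : ∀ m : ℕ, d ≠ -m) (y : Fin p → ℂ) :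
    Summable fun kq : ℕ × (Fin p → ℕ) => (-1) ^ kq.1 * kapSum a b c x kq.1 *
      (((∑ j, kq.2 j).multichoose kq.1 : ℂ) * zeroFTerm d y kq.2) := by
  obtain ⟨C, θ, hC, hθ, hθ1, hb⟩ := exists_norm_tsum_kap_le a b hc hx hx'
  obtain ⟨z, hz, hz1⟩ := exists_between hθ1
  have hz0 : 0 < z := hθ.trans hz
  have hz2 : 0 < 1 - z := by linarith
  have hA := (summable_geometric_of_lt_one (by positivity) ((div_lt_one hz0).mpr hz)).mul_left C
  have hB := summable_pow_mul_zeroFTerm hd y (inv_nonneg.mpr hz2.le)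
  refine .of_norm_bounded (hA.mul_of_nonneg hB
    (fun k => mul_nonneg hC (by positivity)) fun q => by positivity) ?_
  rintro ⟨k, q⟩
  have h1 := multichoose_mul_pow_le hθ.le hz0 hz1 (∑ j, q j) k
  have h2 : ‖kapSum a b c x k‖ ≤ C * θ ^ k := hb k
  simp only [norm_mul, norm_pow, norm_neg, norm_one, one_pow, one_mul, Complex.norm_natCast]
  calc ‖kapSum a b c x k‖ * (((∑ j, q j).multichoose k : ℝ) * ‖zeroFTerm d y q‖)
      ≤ C * θ ^ k * (((∑ j, q j).multichoose k : ℝ) * ‖zeroFTerm d y q‖) := by gcongr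
    _ = C * ((((∑ j, q j).multichoose k : ℝ) * θ ^ k) * ‖zeroFTerm d y q‖) := by ring
    _ ≤ C * (((1 - z)⁻¹ ^ (∑ j, q j) * (θ / z) ^ k) * ‖zeroFTerm d y q‖) := by gcongr
    _ = _ := by ring

/-- `H_A` as the series of products of `kapSum` and of sums over `q`. -/
theorem hasSum_confluentHA {n p : ℕ} {a : ℂ} (ha : ∀ m : ℕ, a ≠ m + 1) (b : Fin n → ℂ)
    {c x : Fin n → ℂ} (hc : ∀ i, ∀ m : ℕ, c i ≠ -m) (hx : ∑ i, ‖x i‖ < 1)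
    (hx' : ∑ i, max (x i).re 0 < 1 / 2) (y : Fin p → ℂ) :
    HasSum (fun k : ℕ => (-1) ^ k * kapSum a b c x k *
      ∑' q : Fin p → ℕ, ((∑ j, q j).multichoose k : ℂ) * zeroFTerm (1 - a) (-y) q)
      (confluentHA a b c x y) := by
  have hd := one_sub_ne_neg_nat ha
  let G : ℕ × (Fin p → ℕ) → ℂ := fun kq => (-1) ^ kq.1 * kapSum a b c x kq.1 *
    (((∑ j, kq.2 j).multichoose kq.1 : ℂ) * zeroFTerm (1 - a) (-y) kq.2)
  have hG : Summable G := summable_kapSum_mul_multichoose a b hc hx hx' hd (-y)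
  have h1 : ∀ q : Fin p → ℕ, HasSum (fun k => G (k, q))
      (lauricellaA (a - (∑ j, q j : ℕ)) b c x * zeroFTerm (1 - a) (-y) q) := fun q => by
    have := (hasSum_lauricellaA_sub a b hc hx hx' (∑ j, q j)).mul_right (zeroFTerm (1 - a) (-y) q)
    convert! this using 2 with k
    simp only [G]; ring
  have hH := summable_confluentHATerm ha b hc hx y
  have h2 : ∑' kq, G kq = confluentHA a b c x y := by
    rw [confluentHA, tsum_eq_tsum_swap hG, tsum_eq_tsum_swap hH]
    refine tsum_congr fun q => ?_
    rw [(h1 q).tsum_eq, lauricellaA, ← tsum_mul_right]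
    exact tsum_congr fun m => (confluentHATerm_eq ha b c x y m q).symm
  rw [← h2]
  have h3 : ∀ k, HasSum (fun q => G (k, q)) ((-1) ^ k * kapSum a b c x k *
      ∑' q : Fin p → ℕ, ((∑ j, q j).multichoose k : ℂ) * zeroFTerm (1 - a) (-y) q) := fun k =>
    by
      simp only [G]
      exact (summable_multichoose_mul_zeroFTerm hd (-y) k).hasSum.mul_left _
  exact hG.hasSum.prod_fiberwise h3

/-! ### From sums with binomial weights to the decomposition formula -/

theorem sum_prod_choose {ι : Type*} [DecidableEq ι] (s : Finset ι) (m : ι → ℕ) (k : ℕ) :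
    ∑ j ∈ piAntidiag s k, ∏ t ∈ s, (m t).choose (j t) = (∑ t ∈ s, m t).choose k := by
  induction s using Finset.cons_induction generalizing k with
  | empty => cases k <;> simp
  | cons a s has ih =>
    rw [sum_cons, piAntidiag_cons, sum_disjiUnion, Nat.add_choose_eq]
    refine sum_congr rfl fun p _ => ?_
    rw [sum_map, ← ih, mul_sum]
    refine sum_congr rfl fun f hf => ?_
    have hfa : f a = 0 := by
      by_contra h
      exact has ((mem_piAntidiag.mp hf).2 a h)
    rw [prod_cons]
    congr 1
    · simp [hfa]
    · refine prod_congr rfl fun t ht => ?_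
      have : t ≠ a := fun h => has (h ▸ ht)
      simp [this]

/-- Vandermonde splits the binomial of |m| over multi-indices j with |j| = k. The product of
binomials vanishes unless m ≥ j, so m may be replaced by m + j. -/
theorem tsum_choose_mul {n : ℕ} (k : ℕ) {u : (Fin n → ℕ) → ℂ}
    (hu : Summable fun m => ((∑ i, m i).choose k : ℂ) * u m) :
    ∑' m, ((∑ i, m i).choose k : ℂ) * u m
      = ∑ j ∈ piAntidiag univ k, ∑' m, (∏ i, ((m i + j i).choose (j i) : ℂ)) * u (m + j) := by
  have e : ∀ m : Fin n → ℕ, ((∑ i, m i).choose k : ℂ)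
      = ∑ j ∈ piAntidiag univ k, ∏ i, ((m i).choose (j i) : ℂ) := fun m => by
    exact_mod_cast (sum_prod_choose univ m k).symm
  have hs : ∀ j ∈ piAntidiag univ k,
      Summable fun m : Fin n → ℕ => (∏ i, ((m i).choose (j i) : ℂ)) * u m := fun j hj => by
    refine .of_norm_bounded hu.norm fun m => ?_
    rw [norm_mul, norm_mul]
    have h1 : ∏ i, (m i).choose (j i) ≤ (∑ i, m i).choose k := by
      rw [← sum_prod_choose]
      exact single_le_sum (f := fun j : Fin n → ℕ => ∏ i, (m i).choose (j i))
        (fun _ _ => Nat.zero_le _) hj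
    have h2 : ‖∏ i, ((m i).choose (j i) : ℂ)‖ ≤ ‖((∑ i, m i).choose k : ℂ)‖ := by
      rw [Complex.norm_natCast, ← Nat.cast_prod, Complex.norm_natCast]
      exact_mod_cast h1
    gcongr
  simp_rw [e, sum_mul]
  rw [Summable.tsum_finsetSum hs]
  refine sum_congr rfl fun j _ => ?_
  have inj : Function.Injective fun m : Fin n → ℕ => m + j := add_left_injective j
  rw [← inj.tsum_eq]
  · exact tsum_congr fun m => rfl
  · refine Function.support_subset_iff'.mpr fun m hm => ?_
    obtain ⟨i, hi⟩ : ∃ i, m i < j i := by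
      by_contra! h
      refine hm ⟨m - j, ?_⟩
      ext i
      simp [h i]
    rw [prod_eq_zero (mem_univ i) (by simp [Nat.choose_eq_zero_of_lt hi]), zero_mul]

theorem choose_mul_pow_div_factorial (x : ℂ) (m j : ℕ) :
    ((m + j).choose j : ℂ) * (x ^ (m + j) / (m + j).factorial)
      = x ^ j / j.factorial * (x ^ m / m.factorial) := by
  have h : ((m + j).choose j : ℂ) * j.factorial * m.factorial = (m + j).factorial := by
    have := Nat.add_choose_mul_factorial_mul_factorial m j
    rw [mul_right_comm] at this
    exact_mod_cast this
  have hm : (m.factorial : ℂ) ≠ 0 := by exact_mod_cast m.factorial_ne_zero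
  have hj : (j.factorial : ℂ) ≠ 0 := by exact_mod_cast j.factorial_ne_zero
  have hc : ((m + j).choose j : ℂ) ≠ 0 := by
    exact_mod_cast (Nat.choose_pos (Nat.le_add_left j m)).ne'
  rw [← h, pow_add]
  field_simp

theorem choose_mul_phi (b c x : ℂ) (m j : ℕ) :
    ((m + j).choose j : ℂ) * phi b c x (m + j) = phi b c x j * phi (b + j) (c + j) x m := by
  have h := choose_mul_pow_div_factorial x m j
  have e : ∀ (b c : ℂ) (m : ℕ), phi b c x m = poch b m / poch c m * (x ^ m / m.factorial) :=
    fun b c m => by rw [phi]; ring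
  rw [e, e, e, mul_left_comm, h, add_comm m j, poch_add, poch_add]
  ring

/-- M!/(M-k)! = k! C(M, k), and after the shift by j each binomial turns the coefficient at m + j
into the one at j times the one at m with parameters b + j, c + j. -/
theorem kapSum_eq_sum {n : ℕ} (a : ℂ) (b : Fin n → ℂ) {c x : Fin n → ℂ}
    (hc : ∀ i, ∀ m : ℕ, c i ≠ -m) (hx : ∑ i, ‖x i‖ < 1) (k : ℕ) :
    kapSum a b c x k = ∑ j ∈ piAntidiag univ k, (k.factorial : ℂ) *
      (∏ i, phi (b i) (c i) (x i) (j i)) *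
      lauricellaA (a + k) (fun s => b s + j s) (fun s => c s + j s) x := by
  have e : ∀ m : Fin n → ℕ, kap a k (∑ i, m i) * ∏ i, phi (b i) (c i) (x i) (m i)
      = ((∑ i, m i).choose k : ℂ) * (k.factorial * poch (a + k) (∑ i, m i - k) *
        ∏ i, phi (b i) (c i) (x i) (m i)) := fun m => by
    rw [kap, Nat.descFactorial_eq_factorial_mul_choose]; push_cast; ring
  have hs := (summable_norm_kap_mul_phi a k b hc hx).of_norm
  simp only [e] at hs
  rw [kapSum]
  simp only [e]
  rw [tsum_choose_mul k hs]
  refine sum_congr rfl fun j hj => ?_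
  have hj' : ∑ i, j i = k := (mem_piAntidiag.mp hj).1
  rw [lauricellaA, ← tsum_mul_left]
  refine tsum_congr fun m => ?_
  have h1 : ∑ i, (m + j) i - k = ∑ i, m i := by simp [sum_add_distrib, hj']
  have h2 : (∏ i, ((m i + j i).choose (j i) : ℂ)) * ∏ i, phi (b i) (c i) (x i) ((m + j) i)
      = (∏ i, phi (b i) (c i) (x i) (j i)) * ∏ i, phi (b i + j i) (c i + j i) (x i) (m i) := by
    rw [← prod_mul_distrib, ← prod_mul_distrib]
    exact prod_congr rfl fun i _ => choose_mul_phi _ _ _ _ _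
  rw [h1, lauricellaATerm_eq, kap_zero]
  linear_combination (k.factorial : ℂ) * poch (a + k) (∑ i, m i) * h2

theorem summable_choose_mul_zeroFTerm {p : ℕ} {d : ℂ} (hd : ∀ m : ℕ, d ≠ -m) (y : Fin p → ℂ)
    (l : ℕ) : Summable fun q : Fin p → ℕ => ((∑ j, q j).choose l : ℂ) * zeroFTerm d y q := by
  refine .of_norm_bounded (summable_pow_mul_zeroFTerm hd y zero_le_two) fun q => ?_
  rw [norm_mul, Complex.norm_natCast]
  gcongr
  exact_mod_cast Nat.choose_le_two_pow _ _

theorem tsum_choose_mul_zeroFTerm {p : ℕ} {d : ℂ} (hd : ∀ m : ℕ, d ≠ -m) (y : Fin p → ℂ) (l : ℕ) :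
    ∑' q : Fin p → ℕ, ((∑ j, q j).choose l : ℂ) * zeroFTerm d y q
      = ∑ j ∈ piAntidiag univ l, (poch d l)⁻¹ * (∏ t, (y t ^ j t / (j t).factorial)) *
        zeroF (d + l) y := by
  rw [tsum_choose_mul l (summable_choose_mul_zeroFTerm hd y l)]
  refine sum_congr rfl fun j hj => ?_
  have hj' : ∑ i, j i = l := (mem_piAntidiag.mp hj).1
  rw [zeroF, ← tsum_mul_left]
  refine tsum_congr fun q => ?_
  have h1 : ∑ i, (q + j) i = l + ∑ i, q i := by simp [sum_add_distrib, hj', add_comm]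
  have h2 : (∏ i, ((q i + j i).choose (j i) : ℂ)) *
      ∏ i, (y i ^ (q + j) i / (((q + j) i).factorial : ℂ))
      = (∏ t, (y t ^ j t / ((j t).factorial : ℂ))) * ∏ t, (y t ^ q t / ((q t).factorial : ℂ)) := by
    rw [← prod_mul_distrib, ← prod_mul_distrib]
    exact prod_congr rfl fun i _ => choose_mul_pow_div_factorial _ _ _
  rw [zeroFTerm, zeroFTerm, h1, poch_add, mul_inv]
  linear_combination (poch d l)⁻¹ * (poch (d + l) (∑ i, q i))⁻¹ * h2

/-- Vandermonde for C(Q+k, k+1); the term l = 0 drops out because C(k, k+1) = 0. -/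
theorem multichoose_eq_sum (Q k : ℕ) :
    Q.multichoose (k + 1) = ∑ l ∈ Icc 1 (k + 1), k.choose (l - 1) * Q.choose l := by
  have hI : Icc 1 (k + 1) = Ico (0 + 1) (k + 1 + 1) := by ext; simp
  rw [hI, ← sum_Ico_add' (fun l => k.choose (l - 1) * Q.choose l), ← range_eq_Ico,
    Nat.multichoose_eq, show Q + (k + 1) - 1 = Q + k by omega, Nat.add_choose_eq,
    Nat.sum_antidiagonal_eq_sum_range_succ (fun i j => Q.choose i * k.choose j),
    sum_range_succ']
  simp only [Nat.sub_zero, Nat.choose_succ_self, mul_zero, add_zero, Nat.add_sub_cancel]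
  refine sum_congr rfl fun i hi => ?_
  rw [show k + 1 - (i + 1) = k - i by omega,
    Nat.choose_symm (Nat.lt_succ_iff.mp (mem_range.mp hi)), mul_comm]

theorem decompTerm_eq {n p : ℕ} {a : ℂ} (ha : ∀ m : ℕ, a ≠ m + 1) (b : Fin n → ℂ)
    {c x : Fin n → ℂ} (hc : ∀ i, ∀ m : ℕ, c i ≠ -m) (hx : ∑ i, ‖x i‖ < 1) (y : Fin p → ℂ)
    (k : ℕ) :
    decompTerm a b c x y (k + 1) = (-1) ^ (k + 1) * kapSum a b c x (k + 1) *
      ∑' q : Fin p → ℕ, ((∑ j, q j).multichoose (k + 1) : ℂ) * zeroFTerm (1 - a) (-y) q := by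
  have hd := one_sub_ne_neg_nat ha
  have e : ∑' q : Fin p → ℕ, ((∑ j, q j).multichoose (k + 1) : ℂ) * zeroFTerm (1 - a) (-y) q
      = ∑ l ∈ Icc 1 (k + 1), (k.choose (l - 1) : ℂ) *
        ∑' q : Fin p → ℕ, ((∑ j, q j).choose l : ℂ) * zeroFTerm (1 - a) (-y) q := by
    simp_rw [← tsum_mul_left]
    rw [← Summable.tsum_finsetSum fun l _ =>
      (summable_choose_mul_zeroFTerm hd (-y) l).mul_left _]
    refine tsum_congr fun q => ?_
    rw [multichoose_eq_sum]
    push_cast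
    rw [sum_mul]
    exact sum_congr rfl fun l _ => by ring
  rw [e, decompTerm, kapSum_eq_sum a b hc hx, mul_sum]
  refine sum_congr rfl fun l _ => ?_
  rw [tsum_choose_mul_zeroFTerm hd, mul_sum, sum_mul]
  refine sum_congr rfl fun i _ => ?_
  rw [mul_sum, mul_sum]
  refine sum_congr rfl fun j hj => ?_
  have hj' : ∑ t, j t = l := (mem_piAntidiag.mp hj).1
  have h1 : ∏ t, ((-y) t ^ j t / ((j t).factorial : ℂ))
      = (-1) ^ l * ∏ t, (y t ^ j t / ((j t).factorial : ℂ)) := by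
    rw [← hj', ← prod_pow_eq_pow_sum, ← prod_mul_distrib]
    refine prod_congr rfl fun t _ => ?_
    rw [Pi.neg_apply, neg_pow]; ring
  have h2 : ∏ s, phi (b s) (c s) (x s) (i s) = (∏ s, poch (b s) (i s)) / (∏ s, poch (c s) (i s)) *
      ∏ s, (x s ^ i s / ((i s).factorial : ℂ)) := by
    rw [← prod_div_distrib, ← prod_mul_distrib]
    refine prod_congr rfl fun s _ => ?_
    rw [phi]; ring
  rw [h1, h2, Nat.add_sub_cancel, pow_add (-1 : ℂ) (k + 1) l]
  ring

theorem zeroFTerm_const (d y : ℂ) (q : ℕ) :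
    zeroFTerm d (fun _ : Fin 1 => y) (fun _ => q) = zeroF1Term d y q := by
  simp [zeroFTerm, zeroF1Term]; ring

theorem summable_zeroF1Term {d : ℂ} (hd : ∀ m : ℕ, d ≠ -m) (y : ℂ) :
    Summable (zeroF1Term d y) := by
  have h := (summable_norm_zeroFTerm hd fun _ : Fin 1 => y).of_norm
  rw [← (Equiv.funUnique (Fin 1) ℕ).symm.summable_iff] at h
  exact h.congr fun q => zeroFTerm_const d y q

theorem zeroF_const (d y : ℂ) : zeroF d (fun _ : Fin 1 => y) = zeroF1 d y := by
  rw [zeroF, zeroF1, ← (Equiv.funUnique (Fin 1) ℕ).symm.tsum_eq]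
  exact tsum_congr fun q => zeroFTerm_const d y q

theorem decompTermOne_eq {n : ℕ} (a : ℂ) (b c x : Fin n → ℂ) (y : ℂ) (k : ℕ) :
    decompTermOne a b c x y k = decompTerm a b c x (fun _ : Fin 1 => y) k := by
  have h : ∀ l : ℕ, piAntidiag (univ : Finset (Fin 1)) l = {fun _ => l} := fun l => by
    ext f
    simp [funext_iff, Fin.forall_fin_one]
  have hneg : -(fun _ : Fin 1 => y) = fun _ => -y := rfl
  simp only [decompTermOne, decompTerm, h, sum_singleton, hneg, zeroF_const, prod_const,
    card_univ, Fintype.card_fin, pow_one]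

/-! ### Euler operators on power series -/

theorem prod_update_pow {n : ℕ} (z : Fin n → ℂ) (i : Fin n) (t : ℂ) (m : Fin n → ℕ) :
    ∏ j, Function.update z i t j ^ m j = t ^ m i * ∏ j ∈ univ.erase i, z j ^ m j := by
  rw [← mul_prod_erase univ _ (mem_univ i), Function.update_self]
  congr 1
  refine prod_congr rfl fun j hj => ?_
  rw [Function.update_of_ne (mem_erase.mp hj).1]

/-- Termwise application of `z_i ∂/∂z_i` to a power series. -/
theorem hasSum_mul_deriv_powerSeries {n : ℕ} (A : (Fin n → ℕ) → ℂ) (z : Fin n → ℂ) (i : Fin n)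
    {ρ : ℝ} (hρ : ‖z i‖ < ρ)
    (h : Summable fun m => A m * ∏ j, Function.update z i (ρ : ℂ) j ^ m j) :
    HasSum (fun m => (m i : ℂ) * (A m * ∏ j, z j ^ m j))
      (z i * deriv (fun t => ∑' m, A m * ∏ j, Function.update z i t j ^ m j) (z i)) := by
  have hρ0 : 0 ≤ ρ := (norm_nonneg _).trans hρ.le
  -- On the disc of radius ρ in the i-th variable, every term is dominated by its value at ρ.
  have key := Complex.hasSum_deriv_of_summable_norm (U := Metric.ball (0 : ℂ) ρ)
    (F := fun m t => A m * ∏ j, Function.update z i t j ^ m j) h.norm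
    (fun m => by simp only [prod_update_pow]; fun_prop) Metric.isOpen_ball
    (fun m t ht => by
      have ht' : ‖t‖ ≤ ρ := (mem_ball_zero_iff.mp ht).le
      simp only [prod_update_pow, norm_mul, norm_pow, Complex.norm_real, Real.norm_of_nonneg hρ0]
      gcongr)
    (mem_ball_zero_iff.mpr hρ)
  convert! key.mul_left (z i) using 2 with m
  have hd : deriv (fun t => A m * ∏ j, Function.update z i t j ^ m j) (z i)
      = A m * (((m i : ℂ) * z i ^ (m i - 1)) * ∏ j ∈ univ.erase i, z j ^ m j) := by
    simp only [prod_update_pow]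
    simp
  rw [hd, ← mul_prod_erase univ _ (mem_univ i)]
  rcases Nat.eq_zero_or_pos (m i) with h0 | h0
  · simp [h0]
  · obtain ⟨r, hr⟩ := Nat.exists_eq_succ_of_ne_zero h0.ne'
    rw [hr, Nat.succ_eq_add_one, Nat.add_sub_cancel, pow_succ]
    ring

theorem hasSum_euler_powerSeries {n : ℕ} (A : (Fin n → ℕ) → ℂ) (z : Fin n → ℂ)
    (h : ∀ i, ∃ ρ : ℝ, ‖z i‖ < ρ ∧
      Summable fun m => A m * ∏ j, Function.update z i (ρ : ℂ) j ^ m j) :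
    HasSum (fun m => ((∑ i, m i : ℕ) : ℂ) * (A m * ∏ j, z j ^ m j))
      (∑ i, z i * deriv (fun t => ∑' m, A m * ∏ j, Function.update z i t j ^ m j) (z i)) := by
  choose ρ hρ hs using h
  refine (hasSum_sum fun i (_ : i ∈ univ) => hasSum_mul_deriv_powerSeries A z i (hρ i)
    (hs i)).congr_fun fun m => ?_
  push_cast
  rw [sum_mul]

/-- The coefficient of `x^m` in `F_A`. -/
noncomputable def lauricellaCoeff {n : ℕ} (a : ℂ) (b c : Fin n → ℂ) (m : Fin n → ℕ) : ℂ :=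
  poch a (∑ i, m i) * ∏ i, (poch (b i) (m i) / (poch (c i) (m i) * (m i).factorial))

/-- The coefficient of `y^q` in `₀F_p(d; -y)`. -/
noncomputable def zeroFCoeff {p : ℕ} (d : ℂ) (q : Fin p → ℕ) : ℂ :=
  (poch d (∑ j, q j))⁻¹ * ∏ j, ((-1) ^ q j / ((q j).factorial : ℂ))

theorem lauricellaCoeff_mul {n : ℕ} (a : ℂ) (b c x : Fin n → ℂ) (m : Fin n → ℕ) :
    lauricellaCoeff a b c m * ∏ i, x i ^ m i = lauricellaATerm a b c x m := by
  rw [lauricellaCoeff, lauricellaATerm, mul_assoc, ← prod_mul_distrib]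

theorem zeroFCoeff_mul {p : ℕ} (d : ℂ) (y : Fin p → ℂ) (q : Fin p → ℕ) :
    zeroFCoeff d q * ∏ j, y j ^ q j = zeroFTerm d (-y) q := by
  rw [zeroFCoeff, zeroFTerm, mul_assoc, ← prod_mul_distrib]
  congr 1
  refine prod_congr rfl fun j _ => ?_
  rw [Pi.neg_apply, neg_pow]; ring

theorem poch_natCast (Q k : ℕ) : poch (Q : ℂ) k = k.factorial * (Q.multichoose k : ℂ) := by
  have h : ∀ k : ℕ, poch (Q : ℂ) k = (Q.ascFactorial k : ℂ) := fun k => by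
    induction k with
    | zero => simp [poch]
    | succ k ih => rw [poch_succ, ih, Nat.ascFactorial_succ]; push_cast; ring
  rw [h, Nat.ascFactorial_eq_factorial_mul_choose', Nat.multichoose_eq]
  push_cast; ring

/-- (-M)_k = (-1)^k M!/(M-k)! and (a)_M = (a)_k (a+k)_{M-k} for k ≤ M. This produces the (a)_k that
cancels the denominator of the operator series. -/
theorem poch_neg_natCast_mul (a : ℂ) (M k : ℕ) :
    poch (-(M : ℂ)) k * poch a M = (-1) ^ k * poch a k * kap a k M := by
  have h : poch (-(M : ℂ)) k = (-1) ^ k * (M.descFactorial k : ℂ) := by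
    induction k with
    | zero => simp [poch]
    | succ k ih =>
      rw [poch_succ, ih, Nat.descFactorial_succ]
      rcases le_or_gt k M with hk | hk
      · push_cast [hk]; ring
      · rw [Nat.descFactorial_of_lt hk]; simp
  rcases lt_or_ge M k with hk | hk
  · rw [h, kap_of_lt a hk, Nat.descFactorial_of_lt hk]; simp
  · obtain ⟨j, rfl⟩ := Nat.exists_eq_add_of_le hk
    rw [h, kap, poch_add, Nat.add_sub_cancel_left]; ring

theorem opPoch_eulerY {n p : ℕ} (F : (Fin n → ℂ) → ℂ) {d : ℂ} (hd : ∀ m : ℕ, d ≠ -m) (k : ℕ)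
    (x : Fin n → ℂ) (y : Fin p → ℂ) :
    opPoch eulerY k (fun x y => F x * zeroF d (-y)) x y
      = F x * ∑' q : Fin p → ℕ, poch ((∑ j, q j : ℕ) : ℂ) k * zeroFTerm d (-y) q := by
  have hs : ∀ (k : ℕ) (y : Fin p → ℂ), Summable fun q : Fin p → ℕ =>
      poch ((∑ j, q j : ℕ) : ℂ) k * zeroFTerm d (-y) q := fun k y => by
    simp only [poch_natCast, mul_assoc]
    exact (summable_multichoose_mul_zeroFTerm hd (-y) k).mul_left _
  induction k generalizing x y with
  | zero => simp [opPoch, poch, zeroF]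
  | succ k ih =>
    have e : ∀ (y : Fin p → ℂ) (q : Fin p → ℕ), poch ((∑ j, q j : ℕ) : ℂ) k * zeroFTerm d (-y) q
        = poch ((∑ j, q j : ℕ) : ℂ) k * zeroFCoeff d q * ∏ j, y j ^ q j := fun y q => by
      rw [← zeroFCoeff_mul]; ring
    have h1 := hasSum_euler_powerSeries
      (fun q : Fin p → ℕ => poch ((∑ j, q j : ℕ) : ℂ) k * zeroFCoeff d q) y fun j =>
      ⟨‖y j‖ + 1, lt_add_one _, (hs k _).congr fun q => e _ q⟩
    simp only [← e] at h1
    have hf : opPoch eulerY k (fun (x : Fin n → ℂ) (y : Fin p → ℂ) => F x * zeroF d (-y))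
        = fun x y => F x * ∑' q : Fin p → ℕ, poch ((∑ j, q j : ℕ) : ℂ) k * zeroFTerm d (-y) q :=
      funext fun x => funext fun y => ih x y
    simp only [opPoch, hf, eulerY]
    simp only [deriv_const_mul_field']
    have h2 : ∑ j, y j * (F x * deriv (fun t => ∑' q : Fin p → ℕ, poch ((∑ j, q j : ℕ) : ℂ) k *
        zeroFTerm d (-Function.update y j t) q) (y j))
        = F x * ∑' q : Fin p → ℕ, ((∑ j, q j : ℕ) : ℂ) *
          (poch ((∑ j, q j : ℕ) : ℂ) k * zeroFTerm d (-y) q) := by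
      rw [h1.tsum_eq, mul_sum]
      exact sum_congr rfl fun j _ => by ring
    rw [h2, mul_left_comm, ← mul_add, ← tsum_mul_left,
      ← h1.summable.tsum_add ((hs k y).mul_left _)]
    congr 1
    refine tsum_congr fun q => ?_
    rw [poch_succ]; ring

theorem isOpen_norm_sum_lt {n : ℕ} : IsOpen {x : Fin n → ℂ | ∑ i, ‖x i‖ < 1} :=
  isOpen_lt (by fun_prop) continuous_const

/-- Each monomial x^m is an eigenvector with eigenvalue -|m|. The formula holds only on an open set,
so the induction hypothesis is used on a neighbourhood of the point before differentiating. -/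
theorem opPoch_neg_eulerX {n p : ℕ} (a : ℂ) (b : Fin n → ℂ) {c : Fin n → ℂ}
    (hc : ∀ i, ∀ m : ℕ, c i ≠ -m) (W : (Fin p → ℂ) → ℂ) (k : ℕ) {x : Fin n → ℂ}
    (hx : ∑ i, ‖x i‖ < 1) (y : Fin p → ℂ) :
    opPoch (fun g x y => -eulerX g x y) k (fun x y => lauricellaA a b c x * W y) x y
      = (∑' m : Fin n → ℕ, poch (-((∑ i, m i : ℕ) : ℂ)) k * lauricellaATerm a b c x m) * W y := by
  have hs : ∀ (k : ℕ) {x : Fin n → ℂ}, ∑ i, ‖x i‖ < 1 → Summable fun m : Fin n → ℕ =>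
      poch (-((∑ i, m i : ℕ) : ℂ)) k * lauricellaATerm a b c x m := fun k x hx => by
    refine ((summable_norm_kap_mul_phi a k b hc hx).of_norm.mul_left
      ((-1) ^ k * poch a k)).congr fun m => ?_
    rw [lauricellaATerm_eq, kap_zero, ← mul_assoc, ← mul_assoc, poch_neg_natCast_mul]
  induction k generalizing x with
  | zero => simp [opPoch, poch, lauricellaA]
  | succ k ih =>
    have e : ∀ (x : Fin n → ℂ) (m : Fin n → ℕ),
        poch (-((∑ i, m i : ℕ) : ℂ)) k * lauricellaATerm a b c x m
        = poch (-((∑ i, m i : ℕ) : ℂ)) k * lauricellaCoeff a b c m * ∏ i, x i ^ m i :=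
      fun x m => by rw [← lauricellaCoeff_mul]; ring
    have h1 := hasSum_euler_powerSeries
      (fun m : Fin n → ℕ => poch (-((∑ i, m i : ℕ) : ℂ)) k * lauricellaCoeff a b c m) x fun i => by
        -- Enlarging the modulus of one coordinate by ε < 1 - ∑ ‖x i‖ stays inside the domain.
        obtain ⟨ε, h0, h1⟩ := exists_between (sub_pos.mpr hx)
        refine ⟨‖x i‖ + ε, by linarith, (hs k ?_).congr fun m => e _ m⟩
        rw [← add_sum_erase univ _ (mem_univ i)] at hx h1 ⊢
        rw [Function.update_self, Complex.norm_real, Real.norm_of_nonneg (by positivity)]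
        have : ∑ j ∈ univ.erase i, ‖Function.update x i ((‖x i‖ + ε : ℝ) : ℂ) j‖
            = ∑ j ∈ univ.erase i, ‖x j‖ := sum_congr rfl fun j hj => by
          rw [Function.update_of_ne (mem_erase.mp hj).1]
        rw [this]
        linarith
    simp only [← e] at h1
    have h3 : ∀ i, deriv (fun t => opPoch (fun g x y => -eulerX g x y) k
        (fun x y => lauricellaA a b c x * W y) (Function.update x i t) y) (x i)
        = deriv (fun t => ∑' m : Fin n → ℕ, poch (-((∑ i, m i : ℕ) : ℂ)) k *
          lauricellaATerm a b c (Function.update x i t) m) (x i) * W y := fun i => by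
      rw [← deriv_mul_const_field]
      refine Filter.EventuallyEq.deriv_eq ?_
      have hcont : Continuous fun t : ℂ => Function.update x i t :=
        continuous_const.update i continuous_id
      filter_upwards [(isOpen_norm_sum_lt.preimage hcont).mem_nhds
        (by simpa [Function.update_eq_self] using hx)] with t ht
      exact ih ht
    have hstep : ∀ (T : ((Fin n → ℂ) → (Fin p → ℂ) → ℂ) → (Fin n → ℂ) → (Fin p → ℂ) → ℂ)
        (f : (Fin n → ℂ) → (Fin p → ℂ) → ℂ), opPoch T (k + 1) f x y
        = T (opPoch T k f) x y + k * opPoch T k f x y := fun T f => rfl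
    rw [hstep, ih hx, eulerX]
    simp only [h3]
    have h2 : ∑ i, x i * (deriv (fun t => ∑' m : Fin n → ℕ, poch (-((∑ i, m i : ℕ) : ℂ)) k *
          lauricellaATerm a b c (Function.update x i t) m) (x i) * W y)
        = (∑' m : Fin n → ℕ, ((∑ i, m i : ℕ) : ℂ) *
          (poch (-((∑ i, m i : ℕ) : ℂ)) k * lauricellaATerm a b c x m)) * W y := by
      rw [h1.tsum_eq, sum_mul]
      exact sum_congr rfl fun j _ => by ring
    rw [h2, ← mul_assoc, ← neg_mul, ← add_mul, ← tsum_neg, ← tsum_mul_left,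
      ← h1.summable.neg.tsum_add ((hs k hx).mul_left _)]
    congr 1
    refine tsum_congr fun m => ?_
    rw [poch_succ]; ring

theorem nablaSeriesTerm_eq {n p : ℕ} {a : ℂ} (ha : ∀ m : ℤ, a ≠ m) (b : Fin n → ℂ)
    {c x : Fin n → ℂ} (hc : ∀ i, ∀ m : ℕ, c i ≠ -m) (hx : ∑ i, ‖x i‖ < 1) (y : Fin p → ℂ)
    (k : ℕ) :
    nablaSeriesTerm a k (fun x y => lauricellaA a b c x * zeroF (1 - a) (-y)) x y
      = (-1) ^ k * kapSum a b c x k *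
        ∑' q : Fin p → ℕ, ((∑ j, q j).multichoose k : ℂ) * zeroFTerm (1 - a) (-y) q := by
  have hd : ∀ m : ℕ, 1 - a ≠ -m := one_sub_ne_neg_nat fun m h => ha (m + 1) (by rw [h]; push_cast; rfl)
  have ha0 : poch a k ≠ 0 := poch_ne_zero (fun m h => ha (-m) (by rw [h]; push_cast; rfl)) k
  have hk : (k.factorial : ℂ) ≠ 0 := by exact_mod_cast k.factorial_ne_zero
  have hf : opPoch eulerY k (fun (x : Fin n → ℂ) (y : Fin p → ℂ) =>
      lauricellaA a b c x * zeroF (1 - a) (-y)) = fun x y => lauricellaA a b c x *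
        ∑' q : Fin p → ℕ, poch ((∑ j, q j : ℕ) : ℂ) k * zeroFTerm (1 - a) (-y) q :=
    funext fun x => funext fun y => opPoch_eulerY (lauricellaA a b c) hd k x y
  rw [nablaSeriesTerm, hf, opPoch_neg_eulerX a b hc _ k hx]
  have h1 : ∑' m : Fin n → ℕ, poch (-((∑ i, m i : ℕ) : ℂ)) k * lauricellaATerm a b c x m
      = (-1) ^ k * poch a k * kapSum a b c x k := by
    rw [kapSum, ← tsum_mul_left]
    refine tsum_congr fun m => ?_
    rw [lauricellaATerm_eq, kap_zero, ← mul_assoc, ← mul_assoc, poch_neg_natCast_mul]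
  have h2 : ∑' q : Fin p → ℕ, poch ((∑ j, q j : ℕ) : ℂ) k * zeroFTerm (1 - a) (-y) q
      = k.factorial * ∑' q : Fin p → ℕ, ((∑ j, q j).multichoose k : ℂ) *
        zeroFTerm (1 - a) (-y) q := by
    rw [← tsum_mul_left]
    exact tsum_congr fun q => by rw [poch_natCast, mul_assoc]
  rw [h1, h2]
  field_simp

/-! ### The Gamma quotient and the main theorem -/

/-- The other factor is (a)_M (a)_{-N}. For non-integral a everything is a quotient of finite
nonzero Gamma values, and the symbol is (a)_{M-N} / ((a)_M (a)_{-N}). -/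
theorem nablaSymbol_mul {a : ℂ} (ha : ∀ m : ℤ, a ≠ m) (M N : ℕ) :
    nablaSymbol a M N * (poch a M * ((-1) ^ N * (poch (1 - a) N)⁻¹)) = pochZ a ((M : ℤ) - N) := by
  have h0 : ∀ m : ℕ, a ≠ -m := fun m h => ha (-m) (by rw [h]; push_cast; rfl)
  have h1 := pochZ_sub (a := a) (fun m h => ha (m + 1) (by rw [h]; push_cast; rfl)) 0 N
  rw [poch_zero, one_mul, pochZ_eq_Gamma a _ ha] at h1
  rw [← h1, poch_eq_Gamma a M h0, pochZ_eq_Gamma a _ ha, nablaSymbol]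
  have g1 := Complex.Gamma_ne_zero h0
  have g2 : Complex.Gamma (a + M) ≠ 0 := Complex.Gamma_ne_zero fun m => shift_ne_neg_nat h0 M m
  have g3 : Complex.Gamma (a - N) ≠ 0 := Complex.Gamma_ne_zero fun m h =>
    ha (N - m) (by push_cast; linear_combination h)
  push_cast
  rw [show a + (0 - (N : ℂ)) = a - N by ring, show a + ((M : ℂ) - N) = a + M - N by ring]
  field_simp

theorem isNablaImage_confluentHA {n p : ℕ} {a : ℂ} (ha : ∀ m : ℤ, a ≠ m) (b : Fin n → ℂ)
    {c : Fin n → ℂ} (hc : ∀ i, ∀ m : ℕ, c i ≠ -m) :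
    IsNablaImage a {z : (Fin n → ℂ) × (Fin p → ℂ) | ∑ i, ‖z.1 i‖ < 1}
      (fun x y => lauricellaA a b c x * zeroF (1 - a) (-y))
      (fun x y => confluentHA a b c x y) := by
  have ha' : ∀ m : ℕ, a ≠ m + 1 := fun m h => ha (m + 1) (by rw [h]; push_cast; rfl)
  have hd := one_sub_ne_neg_nat ha'
  refine ⟨fun mq => lauricellaCoeff a b c mq.1 * zeroFCoeff (1 - a) mq.2, ?_⟩
  rintro ⟨x, y⟩ hx
  have hx : ∑ i, ‖x i‖ < 1 := hx
  have e : ∀ mq : (Fin n → ℕ) × (Fin p → ℕ), lauricellaCoeff a b c mq.1 * zeroFCoeff (1 - a) mq.2 *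
      ((∏ i, x i ^ mq.1 i) * ∏ j, y j ^ mq.2 j)
      = lauricellaATerm a b c x mq.1 * zeroFTerm (1 - a) (-y) mq.2 := fun mq => by
    rw [← lauricellaCoeff_mul, ← zeroFCoeff_mul]; ring
  have hF : Summable fun m : Fin n → ℕ => ‖lauricellaATerm a b c x m‖ :=
    (summable_lauricellaATerm a b hc hx).norm
  have hZ : Summable fun q : Fin p → ℕ => ‖zeroFTerm (1 - a) (-y) q‖ :=
    summable_norm_zeroFTerm hd (-y)
  constructor
  · simp only [e]
    exact hF.of_norm.hasSum.mul hZ.of_norm.hasSum (summable_mul_of_summable_norm hF hZ)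
  · refine (summable_confluentHATerm ha' b hc hx y).hasSum.congr_fun ?_
    rintro ⟨m, q⟩
    have h1 := nablaSymbol_mul ha (∑ i, m i) (∑ j, q j)
    have h3 : zeroFCoeff (1 - a) q = (-1) ^ (∑ j, q j) * (poch (1 - a) (∑ j, q j))⁻¹ *
        ∏ j, (((q j).factorial : ℂ))⁻¹ := by
      rw [zeroFCoeff, ← prod_pow_eq_pow_sum, mul_right_comm, ← prod_mul_distrib, mul_comm]
      congr 1
    have h4 : confluentHATerm a b c x y (m, q) = pochZ a (((∑ i, m i : ℕ) : ℤ) - (∑ j, q j : ℕ)) *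
        ((∏ i, (poch (b i) (m i) / (poch (c i) (m i) * (m i).factorial))) * ∏ i, x i ^ m i) *
        ((∏ j, y j ^ q j) * ∏ j, (((q j).factorial : ℂ))⁻¹) := by
      rw [confluentHATerm, ← prod_mul_distrib, ← prod_mul_distrib]
      push_cast
      rfl
    simp only
    rw [h4, ← h1, h3, lauricellaCoeff]
    ring

theorem mainTheorem3 (n p : ℕ) (a : ℂ) (b c : Fin n → ℂ)
    (ha : ∀ m : ℕ, a ≠ m + 1) (hc : ∀ i, ∀ m : ℕ, c i ≠ -m) :
    -- every multiple series that occurs converges absolutely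
    (∀ (x : Fin n → ℂ) (y : Fin p → ℂ), ∑ i, ‖x i‖ < 1 →
      Summable (confluentHATerm a b c x y) ∧
      (∀ i : Fin n → ℕ, Summable (lauricellaATerm (a + ∑ s, (i s : ℂ))
        (fun s => b s + i s) (fun s => c s + i s) x)) ∧
      ∀ l : ℕ, Summable (zeroFTerm (1 - a + l) (-y))) ∧
    -- the symbolic identity, for the Gamma quotient of Euler operators
    ((∀ m : ℤ, a ≠ m) →
      IsNablaImage a {z : (Fin n → ℂ) × (Fin p → ℂ) | ∑ i, ‖z.1 i‖ < 1}
        (fun x y => lauricellaA a b c x * zeroF (1 - a) (-y))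
        (fun x y => confluentHA a b c x y)) ∧
    -- the symbolic identity, for the operator series
    ((∀ m : ℤ, a ≠ m) → ∀ (x : Fin n → ℂ) (y : Fin p → ℂ),
      ∑ i, ‖x i‖ < 1 → ∑ i, max (x i).re 0 < 1 / 2 →
      HasSum (fun k : ℕ => nablaSeriesTerm a k
        (fun x y => lauricellaA a b c x * zeroF (1 - a) (-y)) x y) (confluentHA a b c x y)) ∧
    -- the decomposition formula
    (∀ (x : Fin n → ℂ) (y : Fin p → ℂ),
      ∑ i, ‖x i‖ < 1 → ∑ i, max (x i).re 0 < 1 / 2 →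
      Summable (fun k : ℕ => decompTerm a b c x y (k + 1)) ∧
      confluentHA a b c x y = lauricellaA a b c x * zeroF (1 - a) (-y) +
        ∑' k : ℕ, decompTerm a b c x y (k + 1)) ∧
    -- its case of one variable `y`
    (∀ (x : Fin n → ℂ) (y : ℂ),
      ∑ i, ‖x i‖ < 1 → ∑ i, max (x i).re 0 < 1 / 2 →
      (∀ l : ℕ, Summable (zeroF1Term (1 - a + l) (-y))) ∧
      Summable (fun k : ℕ => decompTermOne a b c x y (k + 1)) ∧
      confluentHA a b c x (fun _ : Fin 1 => y) = lauricellaA a b c x * zeroF1 (1 - a) (-y) +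
        ∑' k : ℕ, decompTermOne a b c x y (k + 1)) := by
  have hd := one_sub_ne_neg_nat ha
  -- The number of y-variables is quantified afresh, since the last claim needs the value 1.
  have hterm : ∀ (p : ℕ) (x : Fin n → ℂ) (y : Fin p → ℂ),
      ∑ i, ‖x i‖ < 1 → ∑ i, max (x i).re 0 < 1 / 2 →
      Summable (fun k : ℕ => decompTerm a b c x y (k + 1)) ∧
      confluentHA a b c x y = lauricellaA a b c x * zeroF (1 - a) (-y) +
        ∑' k : ℕ, decompTerm a b c x y (k + 1) := fun p x y hx hx' => by
    have h := hasSum_confluentHA ha b hc hx hx' y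
    simp only [decompTerm_eq ha b hc hx y]
    refine ⟨(summable_nat_add_iff 1).mpr h.summable, ?_⟩
    -- The term k = 0 is the leading product of F_A and ₀F_p.
    rw [← h.tsum_eq, h.summable.tsum_eq_zero_add]
    simp [kapSum_zero, zeroF]
  refine ⟨fun x y hx => ⟨summable_confluentHATerm ha b hc hx y,
      fun i => summable_lauricellaATerm _ _ (fun s m => shift_ne_neg_nat (hc s) (i s) m) hx,
      fun l => (summable_norm_zeroFTerm (shift_ne_neg_nat hd l) (-y)).of_norm⟩,
    fun ha' => isNablaImage_confluentHA ha' b hc, fun ha' x y hx hx' => ?_, hterm p,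
    fun x y hx hx' => ⟨fun l => summable_zeroF1Term (shift_ne_neg_nat hd l) (-y), ?_⟩⟩
  · simp only [nablaSeriesTerm_eq ha' b hc hx]
    exact hasSum_confluentHA ha b hc hx hx' y
  · simp only [decompTermOne_eq]
    have h := hterm 1 x (fun _ => y) hx hx'
    rwa [show -(fun _ : Fin 1 => y) = fun _ => -y from rfl, zeroF_const] at h
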